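/- Let $n\ge 1$ be an integer. A sequence $c=(c_k)_{k\ge1}$ of nonnegative reals is called an equilibrium (with parameter $n$) if $\sum_{k\ge1}k c_k=1$ and, with $m_0(c)=\sum_{k\ge1}c_k$, $$\Big(2+\frac{k-1}{n}\Big)c_k=\frac1{m_0(c)}\sum_{i=1}^{k-1}c_i\,c_{k-i}\qquad(k\ge2).$$ Let $(G(i))_{i\ge0}$ be i.i.d. Galton–Watson trees with offspring distribution $\frac12(\delta_0+\delta_2)$. The size-biased critical binary Galton–Watson tree $\widehat G$ is the rooted tree consisting of an infinite backbone $x_0,x_1,x_2,\dots$ (where $x_0$ is the root), in which each $x_i$ has exactly two children: $x_{i+1}$ and the root of $G(i)$. An extra vertex $\star$ is joined to the root by an edge; $\star$ is not a leaf. Pruning of a tree $T$: conditionally on $T$, give the edges (including the one at $\star$) i.i.d. lengths with exponential law of parameter $2$. Given these, for every internal vertex $x$ of $T$ let $\pi_x$ be a Poisson point process of marks with rate $1/n$ (for the length) on the branch joining $\star$ to $x$, these processes being independent. Explore the tree from the top down to $\star$, i.e. by decreasing distance to $\star$. Each time an active mark is met, remove the whole subtree above it, replace it by a leaf, and deactivate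 all the marks sent by internal vertices of this subtree (all marks are active at the beginning; the marks which generate a removal are called useful). The resulting tree is $\mathcal P_n(T)$. For an infinite tree, this is understood as follows: a set $U$ of marks is admissible if a mark belongs to $U$ if and only if it is not deactivated by a mark of $U$ lying farther from $\star$; the procedure is well defined if there is exactly one admissible set, which is then the set of useful marks. Then: 1. Almost surely, the procedure is well defined for $T=\widehat G$, and $\mathcal P_n(\widehat G)$ is finite. 2. (Perfect simulation.) Almost surely, there is some $j\ge0$ such that $\pi_{x_j}$ has a mark in the edge just below $x_j$. Almost surely, for every such $j$, the tree obtained from $\widehat G$ by removing everything strictly above $x_j$ (so that $x_j$ becomes a leaf) is finite, and the same procedure, with the same edge lengths and the same processes at the remaining internal vertices, is well defined on this finite tree and yields $\mathcal P_n(\widehat G)$. 3. There is exactly one equilibrium $c^n=(c^n_k)_{k\ge1}$ with parameter $n$, and the number $|L(\mathcal P_n(\widehat G))|$ of leaves of $\mathcal P_n(\widehat G)$ satisfies $$\Pr\big(|L(\mathcal P_n(\widehat G))|=k\big)=k\,c^n_k\qquad\text{for all }k\ge1 .$$ -/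

import Mathlib

open MeasureTheory ProbabilityTheory
open scoped NNReal

namespace ForestFire

/-! ### The equilibrium equation -/

/-- `m₀(c) = ∑_{k ≥ 1} c_k`. -/
noncomputable def m₀ (c : ℕ → ℝ) : ℝ := ∑' k, c k

/-- `c = (c_k)_{k ≥ 1}` is an equilibrium of the coagulation-fragmentation system with parameter
`n` and total mass `1`. Sequences are indexed by `ℕ` with the convention `c 0 = 0`. -/
structure IsEquilibrium (n : ℕ) (c : ℕ → ℝ) : Prop where
  zero : c 0 = 0
  nonneg : ∀ k, 0 ≤ c k
  mass : HasSum (fun k : ℕ => (k : ℝ) * c k) 1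
  eqn : ∀ k : ℕ, 2 ≤ k →
    (2 + ((k : ℝ) - 1) / n) * c k = 1 / m₀ c * ∑ i ∈ Finset.Ico 1 k, c i * c (k - i)

/-! ### Rooted trees

Vertices are words of natural numbers: `[]` is the root `∅` and `v ++ [j]` is the `j`-th child
of `v`. A tree is a prefix-closed set of words containing `[]`. The additional vertex `⋆` below
the root is not represented. The edge just below `v` (joining `v` to its parent, or `∅` to `⋆`)
is identified with `v`. -/

abbrev Vertex := List ℕ

/-- The leaves of `T`: the vertices without children. -/
def leaves (T : Set Vertex) : Set Vertex := {v | v ∈ T ∧ ∀ j : ℕ, v ++ [j] ∉ T}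

/-- The internal vertices (nodes) of `T`. -/
def nodes (T : Set Vertex) : Set Vertex := {v | v ∈ T ∧ ∃ j : ℕ, v ++ [j] ∈ T}

/-- The Galton-Watson tree in which the vertex `u` has `ν u` children. -/
def galtonWatson (ν : Vertex → ℕ) : Set Vertex :=
  {v | ∀ (u : Vertex) (j : ℕ), u ++ [j] <+: v → j < ν u}

/-- The `i`-th vertex of the backbone, `i = 0, 1, 2, …`; the `0`-th one is the root. -/
def spine (i : ℕ) : Vertex := List.replicate i 1

/-- An infinite backbone, with the tree `G i` planted on its `i`-th vertex: that vertex has two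
children, the next vertex of the backbone (child `1`) and the root of `G i` (child `0`). -/
def backboneTree (G : ℕ → Set Vertex) : Set Vertex :=
  {v | ∃ i, v = spine i} ∪ {v | ∃ i, ∃ w ∈ G i, v = spine i ++ 0 :: w}

/-! ### Edge lengths, marks and pruning -/

/-- The distance from `⋆` to `v` when each edge `e` has length `κ e`. -/
noncomputable def height (κ : Vertex → ℝ) (v : Vertex) : ℝ :=
  ∑ i ∈ Finset.range (v.length + 1), κ (v.take i)

/-- The distance from `⋆` to the lower endpoint of the edge `v`, i.e. to the parent of `v`. -/
noncomputable def bottom (κ : Vertex → ℝ) (v : Vertex) : ℝ :=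
  ∑ i ∈ Finset.range v.length, κ (v.take i)

/-- A mark `(x, h)` is sent by the node `x` and lies at distance `h` from `⋆` on the branch
joining `⋆` to `x`. -/
abbrev Mark := Vertex × ℝ

/-- The mark `m` lies in the edge `y`; in particular `y` is an edge of the branch from `⋆` to the
node which sends `m`. -/
def InEdge (κ : Vertex → ℝ) (m : Mark) (y : Vertex) : Prop :=
  y <+: m.1 ∧ bottom κ y < m.2 ∧ m.2 < height κ y

/-- The marks on `T`: each node `x` sends the points of `π x ⊆ (0, ∞)` that fall on the branch
from `⋆` to `x`, which is identified with `(0, height κ x)` through the distance to `⋆`. -/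
def marks (T : Set Vertex) (κ : Vertex → ℝ) (π : Vertex → Set ℝ) : Set Mark :=
  {m | m.1 ∈ nodes T ∧ m.2 ∈ π m.1 ∧ ∃ y, InEdge κ m y}

/-- If a pruning takes place at `m'`, then it deactivates `m`: going down the tree, `m'` is met
before `m`, and the node sending `m` belongs to the subtree above `m'`. -/
def Deactivates (κ : Vertex → ℝ) (m' m : Mark) : Prop :=
  m.2 < m'.2 ∧ ∃ y, InEdge κ m' y ∧ y <+: m.1

/-- `U` is a possible outcome (as the set of useful marks) of the exploration of the tree from
its top down to `⋆`: a mark generates a pruning if and only if no pruning met before has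
deactivated it. -/
def IsUsefulSet (T : Set Vertex) (κ : Vertex → ℝ) (π : Vertex → Set ℝ) (U : Set Mark) : Prop :=
  ∀ m, m ∈ U ↔ m ∈ marks T κ π ∧ ∀ m' ∈ U, ¬ Deactivates κ m' m

/-- The pruning procedure makes sense: its rule determines the set of useful marks. -/
def PruningWellDefined (T : Set Vertex) (κ : Vertex → ℝ) (π : Vertex → Set ℝ) : Prop :=
  ∃! U, IsUsefulSet T κ π U

/-- The set of useful marks (meaningful if `PruningWellDefined T κ π`: it is then the only
set `U` such that `IsUsefulSet T κ π U`). -/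
def useful (T : Set Vertex) (κ : Vertex → ℝ) (π : Vertex → Set ℝ) : Set Mark :=
  ⋃₀ {U | IsUsefulSet T κ π U}

/-- The pruned tree: what lies above a useful mark is removed and replaced by a leaf. If the mark
lies in the edge `y`, this leaf is called `y`, and the strict descendants of `y` are removed. -/
def prune (T : Set Vertex) (κ : Vertex → ℝ) (π : Vertex → Set ℝ) : Set Vertex :=
  {v | v ∈ T ∧ ∀ m ∈ useful T κ π, ∀ y, InEdge κ m y → y <+: v → y = v}

/-- The subtree of `T` in which everything strictly above `x` is removed (`x` becomes a leaf). -/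
def truncate (T : Set Vertex) (x : Vertex) : Set Vertex := {v | v ∈ T ∧ (x <+: v → x = v)}

/-! ### Poisson point processes and independence -/

/-- The random set `N` is a (homogeneous) Poisson point process with rate `r` on `(0, ∞)`. -/
structure IsPoissonPointProcess {Ω : Type*} [MeasurableSpace Ω] (P : Measure Ω) (r : ℝ≥0)
    (N : Ω → Set ℝ) : Prop where
  measurable_count : ∀ B : Set ℝ, MeasurableSet B → B ⊆ Set.Ioi 0 →
    Measurable fun ω => (N ω ∩ B).encard
  count_law : ∀ B : Set ℝ, MeasurableSet B → B ⊆ Set.Ioi 0 → volume B ≠ ⊤ →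
    ∀ k : ℕ, P {ω | (N ω ∩ B).encard = k} = poissonMeasure (r * (volume B).toNNReal) {k}
  count_indep : ∀ B : ℕ → Set ℝ, (∀ i, MeasurableSet (B i)) → (∀ i, B i ⊆ Set.Ioi 0) →
    (∀ i, volume (B i) ≠ ⊤) → Pairwise (fun i j => Disjoint (B i) (B j)) →
    iIndepFun (fun i ω => (N ω ∩ B i).encard) P

/-- The `σ`-algebra generated by a random set of points in `(0, ∞)`, through its counts. -/
@[reducible] noncomputable def pointSigma {Ω : Type*} (N : Ω → Set ℝ) : MeasurableSpace Ω :=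
  ⨆ (B : Set ℝ) (_ : MeasurableSet B) (_ : B ⊆ Set.Ioi 0),
    MeasurableSpace.comap (fun ω => (N ω ∩ B).encard) ⊤

/-- The family of the `σ`-algebras generated by each offspring number `ν i v`, each edge length
`κ v` and each point process `π v`. -/
@[reducible] noncomputable def inputSigma {Ω : Type*} (ν : ℕ → Vertex → Ω → ℕ) (κ : Vertex → Ω → ℝ)
    (π : Vertex → Ω → Set ℝ) : (ℕ × Vertex) ⊕ (Vertex ⊕ Vertex) → MeasurableSpace Ω
  | .inl p => MeasurableSpace.comap (ν p.1 p.2) inferInstance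
  | .inr (.inl v) => MeasurableSpace.comap (κ v) inferInstance
  | .inr (.inr v) => pointSigma (π v)

/-- `(ν, κ, π)` are the random objects used to build and prune a size-biased binary critical
Galton-Watson tree: offspring numbers `ν i v` with law `(δ₀ + δ₂) / 2` (those of the `i`-th
planted tree), edge lengths `κ v` with the exponential law of parameter `2`, and Poisson point
processes `π v` with rate `1 / n`, all mutually independent. -/
structure IsInput {Ω : Type*} [MeasurableSpace Ω] (P : Measure Ω) (n : ℕ)
    (ν : ℕ → Vertex → Ω → ℕ) (κ : Vertex → Ω → ℝ) (π : Vertex → Ω → Set ℝ) : Prop where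
  measurable_offspring : ∀ i v, Measurable (ν i v)
  offspring_zero : ∀ i v, P {ω | ν i v ω = 0} = 1 / 2
  offspring_two : ∀ i v, P {ω | ν i v ω = 2} = 1 / 2
  measurable_length : ∀ v, Measurable (κ v)
  length_law : ∀ v, P.map (κ v) = expMeasure 2
  poisson : ∀ v, IsPoissonPointProcess P (1 / (n : ℝ≥0)) (π v)
  indep : iIndep (inputSigma ν κ π) P

/-- The size-biased binary critical Galton-Watson tree. -/
def sizeBiasedTree {Ω : Type*} (ν : ℕ → Vertex → Ω → ℕ) (ω : Ω) : Set Vertex :=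
  backboneTree fun i => galtonWatson fun v => ν i v ω

/-- The pruned size-biased binary critical Galton-Watson tree. -/
def prunedTree {Ω : Type*} (ν : ℕ → Vertex → Ω → ℕ) (κ : Vertex → Ω → ℝ)
    (π : Vertex → Ω → Set ℝ) (ω : Ω) : Set Vertex :=
  prune (sizeBiasedTree ν ω) (fun v => κ v ω) (fun v => π v ω)

/-- The vertex `spine j` sends a mark to the edge just below it. -/
def HasOwnMark {Ω : Type*} (κ : Vertex → Ω → ℝ) (π : Vertex → Ω → Set ℝ) (ω : Ω) (j : ℕ) : Prop :=
  ∃ h ∈ π (spine j) ω, InEdge (fun v => κ v ω) (spine j, h) (spine j)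

end ForestFire

/-! The pathwise statements rest on one observation. If the backbone vertex `spine j` sends a mark
to the edge just below it, this edge is always cut: either this mark is useful, or it is deactivated
by a useful mark, which then lies higher in the same edge. Every mark sent from at or above `spine
j` to a point below this edge is deactivated along with it (`not_crosses_of_mem`), so what lies
above `spine j` has no influence below it. Such j occur arbitrarily far along the backbone
(`IsInput.ae_own_mark`) and the planted trees are finite (`IsInput.ae_extinct`). After the crossing
marks are discarded, only finitely many marks can influence a given one: deactivation becomes well
founded and the rule defining useful marks is a recursion with exactly one solution. The same
screening shows that truncation at `spine j` does not change the pruned tree (`prune_truncate`).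

For the law, call a node alive above v if no cut separates it from the lower end of the edge v. The
alive set above v is obtained by grafting those of the two children and emptying the result if one
of its members sends a mark to the edge v (`coe_alive_eq`). Given the lengths, a vertex sends
independent marks to the disjoint edges below it; integration over an exponential length shows that
k given senders all miss an edge with probability 2/(2 + k/n), independently over edges
(`IsInput.iIndep_blockSigma`). Hence, with r_k = 2 + (k+1)/n, the numbers of alive nodes in a
planted tree and in the whole tree have laws p and s satisfying r_k p_{k+1} = ∑ p_i p_j and r_k
s_{k+1} = 2 ∑ p_i s_j, the sums being over i + j = k; the factor 2 reflects that a backbone vertex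
always branches. The pruned tree has one more leaf than alive nodes.

Both equations are monotone in the initial value, so each has at most one probability solution
(`IsQuadraticLaw.unique`, `IsLinearLaw.unique`). Symmetrising the convolution shows that (k+1) p_k,
normalised, solves the linear equation, hence equals s. Finally c_{k+1} = p_k / ∑ (j+1) p_j sets up
a correspondence between probability solutions of the quadratic equation and equilibria, which
yields existence, uniqueness and s_k = (k+1) c_{k+1}. -/

namespace ForestFire

/-! ### Binary trees and cut edges -/

/-- `T` is the binary tree in which the vertex `v` has `N v ∈ {0, 2}` children. -/
structure IsBinary (T : Set Vertex) (N : Vertex → ℕ) : Prop where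
  root : [] ∈ T
  child : ∀ v j, v ++ [j] ∈ T ↔ v ∈ T ∧ j < N v
  two : ∀ v, N v = 0 ∨ N v = 2

/-- The edge `y` carries a mark of `U`. -/
def IsCut (κ : Vertex → ℝ) (U : Set Mark) (y : Vertex) : Prop := ∃ m ∈ U, InEdge κ m y

/-- The vertex `y ++ z` sends a mark to the edge `y`. -/
def Hits (κ : Vertex → ℝ) (π : Vertex → Set ℝ) (y z : Vertex) : Prop :=
  (π (y ++ z) ∩ Set.Ioo (bottom κ y) (height κ y)).Nonempty

section Tree

variable {T : Set Vertex} {N : Vertex → ℕ} {κ : Vertex → ℝ} {π : Vertex → Set ℝ} {U : Set Mark}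

lemma IsBinary.mem_of_append (hT : IsBinary T N) {v w : Vertex} (h : v ++ w ∈ T) : v ∈ T := by
  induction w using List.reverseRecOn with
  | nil => simpa using h
  | append_singleton w j ih =>
    rw [← List.append_assoc, hT.child] at h
    exact ih h.1

lemma IsBinary.mem_nodes (hT : IsBinary T N) {v : Vertex} : v ∈ nodes T ↔ v ∈ T ∧ N v = 2 := by
  constructor
  · rintro ⟨h, j, hj⟩
    refine ⟨h, (hT.two v).resolve_left fun h0 => ?_⟩
    have := ((hT.child v j).1 hj).2
    omega
  · rintro ⟨h, h2⟩
    exact ⟨h, 0, (hT.child v 0).2 ⟨h, by omega⟩⟩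

lemma height_eq (κ : Vertex → ℝ) (y : Vertex) : height κ y = bottom κ y + κ y := by
  simp [height, bottom, Finset.sum_range_succ]

lemma bottom_concat (κ : Vertex → ℝ) (v : Vertex) (j : ℕ) :
    bottom κ (v ++ [j]) = height κ v := by
  unfold bottom height
  simp only [List.length_append, List.length_singleton]
  refine Finset.sum_congr rfl fun i hi => ?_
  rw [List.take_append_of_le_length (by have := Finset.mem_range.1 hi; omega)]

lemma bottom_nonneg (hκ : ∀ v, 0 < κ v) (v : Vertex) : 0 ≤ bottom κ v :=
  Finset.sum_nonneg fun _ _ => (hκ _).le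

lemma height_le_height_append (hκ : ∀ v, 0 < κ v) (v w : Vertex) :
    height κ v ≤ height κ (v ++ w) := by
  induction w using List.reverseRecOn with
  | nil => simp
  | append_singleton w j ih =>
    rw [← List.append_assoc, height_eq κ (v ++ w ++ [j]), bottom_concat]
    have := hκ (v ++ w ++ [j])
    linarith

lemma height_le_bottom (hκ : ∀ v, 0 < κ v) {y x : Vertex} (h : y <+: x) (hne : y ≠ x) :
    height κ y ≤ bottom κ x := by
  obtain ⟨w, rfl⟩ := h
  induction w using List.reverseRecOn with
  | nil => simp at hne
  | append_singleton w j ih =>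
    rw [← List.append_assoc, bottom_concat]
    exact height_le_height_append hκ _ _

/-- Two marks on the branch below `x` are ordered as the edges which contain them. -/
lemma InEdge.prefix_of_le (hκ : ∀ v, 0 < κ v) {m m' : Mark} {y y' x : Vertex}
    (hm : InEdge κ m y) (hm' : InEdge κ m' y') (hy : y <+: x) (hy' : y' <+: x)
    (h : m.2 ≤ m'.2) : y <+: y' := by
  rcases List.prefix_or_prefix_of_prefix hy hy' with h1 | h1
  · exact h1
  · by_cases hne : y' = y
    · rw [hne]
    · have := height_le_bottom hκ h1 hne
      have h2 := hm.2.1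
      have h3 := hm'.2.2
      linarith

lemma InEdge.lt_of_prefix (hκ : ∀ v, 0 < κ v) {m m' : Mark} {y y' : Vertex}
    (hm : InEdge κ m y) (hm' : InEdge κ m' y') (hy : y <+: y') (hne : y ≠ y') : m.2 < m'.2 := by
  have := height_le_bottom hκ hy hne
  have h2 := hm.2.2
  have h3 := hm'.2.1
  linarith

/-- An edge is cut if and only if some node above it, not separated from it by a cut, sends a
mark to it. -/
lemma isCut_iff (hκ : ∀ v, 0 < κ v) (hU : IsUsefulSet T κ π U) (y : Vertex) :
    IsCut κ U y ↔ ∃ z, y ++ z ∈ nodes T ∧ Hits κ π y z ∧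
      ∀ u, u ≠ [] → u <+: z → ¬ IsCut κ U (y ++ u) := by
  constructor
  · rintro ⟨m, hm, hy⟩
    obtain ⟨⟨hx, hh, -⟩, hD⟩ := (hU m).1 hm
    obtain ⟨z, hz⟩ := hy.1
    refine ⟨z, hz ▸ hx, ⟨m.2, hz ▸ hh, hy.2⟩, ?_⟩
    rintro u hu huz ⟨m', hm', hy'⟩
    refine hD m' hm' ⟨hy.lt_of_prefix hκ hy' (List.prefix_append _ _) (by simpa using hu),
      y ++ u, hy', ?_⟩
    rw [← hz]
    exact (List.prefix_append_right_inj y).2 huz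
  · rintro ⟨z, hz, ⟨h, hh, hI⟩, hu⟩
    have hy : InEdge κ (y ++ z, h) y := ⟨List.prefix_append _ _, hI⟩
    by_contra hc
    have hm : (y ++ z, h) ∉ U := fun hm => hc ⟨_, hm, hy⟩
    rw [hU] at hm
    push Not at hm
    obtain ⟨m', hm', hlt, y', hy', hyx⟩ := hm ⟨hz, hh, y, hy⟩
    -- A deactivating mark lies higher on the same branch, hence in the edge `y` itself, which is
    -- then cut, or in an edge separating `y` from the sender.
    obtain ⟨u, rfl⟩ := hy.prefix_of_le hκ hy' (List.prefix_append _ _) hyx hlt.le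
    by_cases h0 : u = []
    · subst h0
      exact hc ⟨m', hm', by simpa using hy'⟩
    · exact hu u h0 ((List.prefix_append_right_inj y).1 hyx) ⟨m', hm', hy'⟩

/-- The nodes above `v`, in coordinates relative to `v`, which are not separated by a cut from the
lower endpoint of the edge `v`. -/
def aliveAbove (T : Set Vertex) (κ : Vertex → ℝ) (U : Set Mark) (v : Vertex) : Set Vertex :=
  {z | v ++ z ∈ nodes T ∧ ∀ u, u <+: z → ¬ IsCut κ U (v ++ u)}

/-- The nodes of the binary tree with root `[]` and subtrees `a` and `b` above the root. -/
def graft (a b : Finset Vertex) : Finset Vertex :=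
  insert [] (a.image (List.cons 0) ∪ b.image (List.cons 1))

open Classical in
/-- Everything is removed if some vertex of `B` sends a mark. -/
noncomputable def cutIf (h : Vertex → Prop) (B : Finset Vertex) : Finset Vertex :=
  if ∃ z ∈ B, h z then ∅ else B

/-- The alive nodes above `v` before a possible cut in the edge `v`, given those above the
children of `v`. -/
def grow (k : ℕ) (a b : Finset Vertex) : Finset Vertex := if k = 2 then graft a b else ∅

/-- The alive nodes above `v` in the pruning of the tree truncated `d` generations above `v`. -/
noncomputable def alive (N : Vertex → ℕ) (e : Vertex → Vertex → Prop) :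
    ℕ → Vertex → Finset Vertex
  | 0, _ => ∅
  | d + 1, v => cutIf (e v) (grow (N v) (alive N e d (v ++ [0])) (alive N e d (v ++ [1])))

/-- Every branch going up from `v` meets a vertex satisfying `Q` within `d` steps. -/
def Terminates (Q : Vertex → Prop) : ℕ → Vertex → Prop
  | 0, v => Q v
  | d + 1, v => Q v ∨ (Terminates Q d (v ++ [0]) ∧ Terminates Q d (v ++ [1]))

lemma cutIf_eq_empty {h : Vertex → Prop} {B : Finset Vertex} (hB : ∃ z ∈ B, h z) :
    cutIf h B = ∅ := if_pos hB

lemma cutIf_eq_self {h : Vertex → Prop} {B : Finset Vertex} (hB : ¬ ∃ z ∈ B, h z) :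
    cutIf h B = B := if_neg hB

lemma card_graft (a b : Finset Vertex) : (graft a b).card = a.card + b.card + 1 := by
  unfold graft
  rw [Finset.card_insert_of_notMem (by simp), Finset.card_union_of_disjoint,
    Finset.card_image_of_injective _ (List.cons_injective),
    Finset.card_image_of_injective _ (List.cons_injective)]
  rw [Finset.disjoint_left]
  simp

lemma Terminates.succ {Q : Vertex → Prop} {d : ℕ} {v : Vertex} (h : Terminates Q d v) :
    Terminates Q (d + 1) v := by
  induction d generalizing v with
  | zero => exact Or.inl h
  | succ d ih => exact h.imp id fun h => ⟨ih h.1, ih h.2⟩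

lemma Terminates.le {Q : Vertex → Prop} {d d' : ℕ} (hd : d ≤ d') {v : Vertex}
    (h : Terminates Q d v) : Terminates Q d' v := by
  induction hd with
  | refl => exact h
  | step _ ih => exact ih.succ

lemma Terminates.mono {Q Q' : Vertex → Prop} (hQ : ∀ v, Q v → Q' v) {d : ℕ} {v : Vertex}
    (h : Terminates Q d v) : Terminates Q' d v := by
  induction d generalizing v with
  | zero => exact hQ _ h
  | succ d ih => exact h.imp (hQ _) fun h => ⟨ih h.1, ih h.2⟩

/-- No edge lies strictly between `v` and the edge below it, so an own mark of `v` forces a cut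
there, whatever happens higher up. -/
lemma aliveAbove_eq_empty (hT : IsBinary T N) (hκ : ∀ v, 0 < κ v) (hU : IsUsefulSet T κ π U)
    {v : Vertex} (h : N v ≠ 2 ∨ Hits κ π v []) : aliveAbove T κ U v = ∅ := by
  rw [Set.eq_empty_iff_forall_notMem]
  rintro z ⟨hz, hu⟩
  have hv : v ∈ nodes T := by
    rcases z with _ | ⟨j, z⟩
    · simpa using hz
    · rw [List.append_cons] at hz
      have := (hT.child v j).1 (hT.mem_of_append hz.1)
      exact hT.mem_nodes.2 ⟨this.1, (hT.two v).resolve_left (by omega)⟩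
  rcases h with h | h
  · exact h (hT.mem_nodes.1 hv).2
  · refine hu [] List.nil_prefix ?_
    rw [List.append_nil, isCut_iff hκ hU]
    refine ⟨[], by simpa using hv, h, ?_⟩
    intro u h1 h2
    exact absurd (List.prefix_nil.1 h2) h1

/-- By `isCut_iff`, whether an edge is cut depends only on the alive nodes above its upper end, so
the alive sets obey the recursion defining `alive`. Stopping at depth `d` loses nothing because
every branch has by then met a vertex with no alive nodes above it. -/
lemma coe_alive_eq (hT : IsBinary T N) (hκ : ∀ v, 0 < κ v) (hU : IsUsefulSet T κ π U)
    {d : ℕ} {v : Vertex} (h : Terminates (fun v => N v ≠ 2 ∨ Hits κ π v []) d v) (hv : v ∈ T) :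
    (alive N (Hits κ π) d v : Set Vertex) = aliveAbove T κ U v := by
  induction d generalizing v with
  | zero => simp [alive, aliveAbove_eq_empty hT hκ hU h]
  | succ d ih =>
    by_cases hQ : N v ≠ 2 ∨ Hits κ π v []
    · rw [aliveAbove_eq_empty hT hκ hU hQ]
      rcases hQ with hQ | hQ
      · simp [alive, grow, cutIf, hQ]
      -- The word `[]`, that is `v` itself, belongs to the graft, and its own mark empties it.
      · simp only [alive, grow, cutIf]
        split_ifs with h2 <;> simp_all [graft]
    · have h2 : N v = 2 := by tauto
      have h' := h.resolve_left hQ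
      have hc0 : v ++ [0] ∈ T := (hT.child v 0).2 ⟨hv, by omega⟩
      have hc1 : v ++ [1] ∈ T := (hT.child v 1).2 ⟨hv, by omega⟩
      have ih0 := ih h'.1 hc0
      have ih1 := ih h'.2 hc1
      have key : ∀ j w, (v ++ j :: w ∈ nodes T ∧
          ∀ u, u ≠ [] → u <+: j :: w → ¬ IsCut κ U (v ++ u)) ↔
          w ∈ aliveAbove T κ U (v ++ [j]) := by
        intro j w
        rw [List.append_cons]
        refine and_congr_right fun _ => ⟨fun H u hu => ?_, fun H u hu hw => ?_⟩
        · rw [← List.append_cons]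
          exact H _ (by simp) (by simpa using hu)
        · rcases u with _ | ⟨i, u⟩
          · simp at hu
          · rw [List.cons_prefix_cons] at hw
            obtain ⟨rfl, hw⟩ := hw
            rw [List.append_cons]
            exact H u hw
      -- The graft satisfies every condition for being alive except the one at `u = []`, which
      -- concerns the edge `v` itself.
      have hB : ∀ z, z ∈ graft (alive N (Hits κ π) d (v ++ [0])) (alive N (Hits κ π) d (v ++ [1]))
          ↔ v ++ z ∈ nodes T ∧ ∀ u, u ≠ [] → u <+: z → ¬ IsCut κ U (v ++ u) := by
        intro z
        rcases z with _ | ⟨j, w⟩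
        · simp only [graft, Finset.mem_insert, true_or, true_iff, List.append_nil]
          refine ⟨hT.mem_nodes.2 ⟨hv, h2⟩, ?_⟩
          intro u h1 h2
          exact absurd (List.prefix_nil.1 h2) h1
        · rw [key]
          have e0 : ∀ w, w ∈ alive N (Hits κ π) d (v ++ [0]) ↔ w ∈ aliveAbove T κ U (v ++ [0]) := by
            intro w; rw [← ih0]; simp
          have e1 : ∀ w, w ∈ alive N (Hits κ π) d (v ++ [1]) ↔ w ∈ aliveAbove T κ U (v ++ [1]) := by
            intro w; rw [← ih1]; simp
          simp only [graft, Finset.mem_insert, Finset.mem_union, Finset.mem_image, e0, e1,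
            List.cons.injEq, reduceCtorEq, false_or]
          constructor
          · rintro (⟨a, ha, rfl, rfl⟩ | ⟨a, ha, rfl, rfl⟩) <;> exact ha
          · intro hw
            have := ((hT.child v j).1 (hT.mem_of_append hw.1.1)).2
            have hj : j = 0 ∨ j = 1 := by omega
            rcases hj with rfl | rfl
            · exact Or.inl ⟨w, hw, rfl, rfl⟩
            · exact Or.inr ⟨w, hw, rfl, rfl⟩
      have hcut : IsCut κ U v ↔ ∃ z ∈ graft (alive N (Hits κ π) d (v ++ [0]))
          (alive N (Hits κ π) d (v ++ [1])), Hits κ π v z := by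
        rw [isCut_iff hκ hU]
        refine exists_congr fun z => ?_
        rw [hB]
        tauto
      have hA : alive N (Hits κ π) (d + 1) v = cutIf (Hits κ π v)
          (graft (alive N (Hits κ π) d (v ++ [0])) (alive N (Hits κ π) d (v ++ [1]))) := by
        rw [alive, grow, if_pos h2]
      ext z
      rw [hA]
      by_cases hc : IsCut κ U v
      · rw [cutIf_eq_empty (hcut.1 hc)]
        simp only [Finset.coe_empty, Set.mem_empty_iff_false, false_iff]
        rintro ⟨-, hz⟩
        exact hz [] List.nil_prefix (by simpa using hc)
      · rw [cutIf_eq_self (fun h => hc (hcut.2 h)), Finset.mem_coe, hB]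
        refine and_congr_right fun _ => forall_congr' fun u => ?_
        by_cases hu : u = []
        · subst hu; simp [hc]
        · simp [hu]

/-! ### The pruned tree and its leaves. -/

lemma useful_eq (h : PruningWellDefined T κ π) (hU : IsUsefulSet T κ π U) :
    useful T κ π = U := by
  obtain ⟨V, hV, hu⟩ := h
  have : {U | IsUsefulSet T κ π U} = {U} := by
    ext W
    exact ⟨fun hW => (hu W hW).trans (hu U hU).symm, fun hW => by rw [hW]; exact hU⟩
  rw [useful, this, Set.sUnion_singleton]

lemma isUsefulSet_useful (h : PruningWellDefined T κ π) :
    IsUsefulSet T κ π (useful T κ π) := by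
  obtain ⟨V, hV, hu⟩ := h
  rw [useful_eq ⟨V, hV, hu⟩ hV]
  exact hV

lemma mem_prune {v : Vertex} :
    v ∈ prune T κ π ↔ v ∈ T ∧ ∀ y, IsCut κ (useful T κ π) y → y <+: v → y = v := by
  refine and_congr_right fun _ => ⟨?_, fun H m hm y hy => H y ⟨m, hm, hy⟩⟩
  rintro H y ⟨m, hm, hy⟩
  exact H m hm y hy

/-- If the alive nodes are finitely many then so are the vertices of the pruned tree, and the
number of leaves exceeds that of the nodes by one. -/
lemma finite_prune_and_ncard_leaves (hT : IsBinary T N) {a : Finset Vertex}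
    (ha : (a : Set Vertex) = aliveAbove T κ (useful T κ π) []) :
    (prune T κ π).Finite ∧ (leaves (prune T κ π)).ncard = a.card + 1 := by
  have hmem : ∀ w, w ∈ a ↔ w ∈ nodes T ∧ ∀ u, u <+: w → ¬ IsCut κ (useful T κ π) u := by
    intro w
    rw [← Finset.mem_coe, ha]
    simp [aliveAbove]
  -- Alive nodes keep both children and no other vertex keeps any: the pruned tree has `2 * a.card +
  -- 1` vertices, and those outside `a` are its leaves.
  have hchild : ∀ w j, w ++ [j] ∈ prune T κ π ↔ w ∈ a ∧ j < 2 := by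
    intro w j
    rw [mem_prune, hmem, hT.child]
    constructor
    · rintro ⟨⟨h1, h2⟩, h3⟩
      have : N w = 2 := (hT.two w).resolve_left (by omega)
      refine ⟨⟨hT.mem_nodes.2 ⟨h1, this⟩, fun u hu hc => ?_⟩, by omega⟩
      have := h3 u hc (hu.trans (List.prefix_append _ _))
      have h4 := hu.length_le
      rw [this] at h4
      simp at h4
    · rintro ⟨⟨h1, h2⟩, h3⟩
      rw [hT.mem_nodes] at h1
      refine ⟨⟨h1.1, by omega⟩, fun y hy hyw => ?_⟩
      rcases List.prefix_concat_iff.1 hyw with h | h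
      · exact h
      · exact absurd hy (h2 y h)
  have hP : prune T κ π =
      ((insert [] (a.image (· ++ [0]) ∪ a.image (· ++ [1])) : Finset Vertex) : Set Vertex) := by
    ext w
    induction w using List.reverseRecOn with
    | nil =>
      simp only [mem_prune, Finset.coe_insert, Set.mem_insert_iff, true_or, iff_true]
      exact ⟨hT.root, fun y _ h => List.prefix_nil.1 h⟩
    | append_singleton w j _ =>
      rw [hchild]
      simp only [Finset.coe_insert, Finset.coe_union, Finset.coe_image, Set.mem_insert_iff,
        Set.mem_union, Set.mem_image, Finset.mem_coe, List.append_eq_nil_iff, reduceCtorEq,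
        and_false, false_or]
      constructor
      · rintro ⟨h1, h2⟩
        have hj : j = 0 ∨ j = 1 := by omega
        rcases hj with rfl | rfl
        · exact Or.inl ⟨w, h1, rfl⟩
        · exact Or.inr ⟨w, h1, rfl⟩
      · rintro (⟨x, hx, h⟩ | ⟨x, hx, h⟩)
        · obtain ⟨rfl, h⟩ := List.append_inj' h rfl
          simp at h
          exact ⟨hx, by omega⟩
        · obtain ⟨rfl, h⟩ := List.append_inj' h rfl
          simp at h
          exact ⟨hx, by omega⟩
  have hcard : (insert [] (a.image (· ++ [0]) ∪ a.image (· ++ [1])) : Finset Vertex).card =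
      a.card + a.card + 1 := by
    rw [Finset.card_insert_of_notMem (by simp), Finset.card_union_of_disjoint,
      Finset.card_image_of_injective _ (List.append_left_injective _),
      Finset.card_image_of_injective _ (List.append_left_injective _)]
    rw [Finset.disjoint_left]
    intro x hx hx'
    obtain ⟨y, -, rfl⟩ := Finset.mem_image.1 hx
    obtain ⟨y', -, h⟩ := Finset.mem_image.1 hx'
    have := (List.append_inj' h rfl).2
    simp at this
  have haP : (a : Set Vertex) ⊆ prune T κ π := by
    intro w hw
    obtain ⟨h1, h2⟩ := (hmem w).1 hw
    exact mem_prune.2 ⟨h1.1, fun y hy hyw => absurd hy (h2 y hyw)⟩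
  have hL : leaves (prune T κ π) = prune T κ π \ a := by
    ext w
    refine and_congr_right fun _ => ⟨fun h hw => h 0 ((hchild w 0).2 ⟨hw, by omega⟩),
      fun h j hj => h ((hchild w j).1 hj).1⟩
  refine ⟨hP ▸ Finset.finite_toSet _, ?_⟩
  rw [hL, Set.ncard_sdiff haP (Finset.finite_toSet _), hP, Set.ncard_coe_finset,
    Set.ncard_coe_finset, hcard]
  omega

end Tree
/-! ### The size-biased tree as a binary tree -/

/-- The offspring numbers of the tree obtained by planting on the backbone the Galton-Watson trees
with offspring numbers `ν i`. -/
def offspring : (ℕ → Vertex → ℕ) → Vertex → ℕ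
  | _, [] => 2
  | ν, 0 :: w => ν 0 w
  | ν, 1 :: w => offspring (fun i => ν (i + 1)) w
  | _, (_ + 2) :: _ => 0

lemma mem_galtonWatson_concat (ν : Vertex → ℕ) (v : Vertex) (j : ℕ) :
    v ++ [j] ∈ galtonWatson ν ↔ v ∈ galtonWatson ν ∧ j < ν v := by
  constructor
  · intro h
    exact ⟨fun u i hu => h u i (hu.trans (List.prefix_append _ _)), h v j (List.prefix_refl _)⟩
  · rintro ⟨h, hj⟩ u i hu
    rcases List.prefix_concat_iff.1 hu with hu | hu
    · obtain ⟨rfl, h2⟩ := List.append_inj' hu rfl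
      simp at h2
      omega
    · exact h u i hu

lemma spine_succ (i : ℕ) : spine (i + 1) = 1 :: spine i := rfl

lemma spine_concat (i : ℕ) : spine i ++ [1] = spine (i + 1) := by
  simp [spine, List.replicate_succ']

lemma length_spine (i : ℕ) : (spine i).length = i := by simp [spine]

lemma nil_mem_backboneTree (G : ℕ → Set Vertex) : [] ∈ backboneTree G := Or.inl ⟨0, rfl⟩

lemma cons_mem_backboneTree (G : ℕ → Set Vertex) (j : ℕ) (w : Vertex) :
    j :: w ∈ backboneTree G ↔
      (j = 0 ∧ w ∈ G 0) ∨ (j = 1 ∧ w ∈ backboneTree fun i => G (i + 1)) := by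
  constructor
  · rintro (⟨i, hi⟩ | ⟨i, u, hu, hi⟩)
    · rcases i with _ | i
      · simp [spine] at hi
      · rw [spine_succ] at hi
        obtain ⟨rfl, rfl⟩ := List.cons.inj hi
        exact Or.inr ⟨rfl, Or.inl ⟨i, rfl⟩⟩
    · rcases i with _ | i
      · obtain ⟨rfl, rfl⟩ := List.cons.inj hi
        exact Or.inl ⟨rfl, hu⟩
      · rw [spine_succ] at hi
        obtain ⟨rfl, rfl⟩ := List.cons.inj hi
        exact Or.inr ⟨rfl, Or.inr ⟨i, u, hu, rfl⟩⟩
  · rintro (⟨rfl, hw⟩ | ⟨rfl, ⟨i, rfl⟩ | ⟨i, u, hu, rfl⟩⟩)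
    · exact Or.inr ⟨0, w, hw, rfl⟩
    · exact Or.inl ⟨i + 1, rfl⟩
    · exact Or.inr ⟨i + 1, u, hu, rfl⟩

/-- Above its first edge the backbone carries a tree of the same kind with the planted trees shifted
by one, which makes induction on the first letter possible. -/
lemma backboneTree_concat (ν : ℕ → Vertex → ℕ) (v : Vertex) (j : ℕ) :
    v ++ [j] ∈ backboneTree (fun i => galtonWatson (ν i)) ↔
      v ∈ backboneTree (fun i => galtonWatson (ν i)) ∧ j < offspring ν v := by
  have hnil : ∀ ν : Vertex → ℕ, [] ∈ galtonWatson ν := by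
    intro ν u i h
    simp at h
  induction v generalizing ν with
  | nil =>
    rw [List.nil_append, cons_mem_backboneTree]
    simp only [hnil, nil_mem_backboneTree, offspring, and_true, true_and]
    omega
  | cons i w ih =>
    have ih' : w ++ [j] ∈ backboneTree (fun i => galtonWatson (ν (i + 1))) ↔
        w ∈ backboneTree (fun i => galtonWatson (ν (i + 1))) ∧
          j < offspring (fun i => ν (i + 1)) w := ih _
    rw [List.cons_append, cons_mem_backboneTree, cons_mem_backboneTree, mem_galtonWatson_concat,
      ih']
    rcases i with _ | _ | i <;> simp [offspring]

lemma offspring_spine (ν : ℕ → Vertex → ℕ) (i : ℕ) : offspring ν (spine i) = 2 := by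
  induction i generalizing ν with
  | zero => rfl
  | succ i ih => exact ih _

lemma offspring_planted (ν : ℕ → Vertex → ℕ) (i : ℕ) (w : Vertex) :
    offspring ν (spine i ++ 0 :: w) = ν i w := by
  induction i generalizing ν with
  | zero => rfl
  | succ i ih => exact ih _

lemma offspring_eq (ν : ℕ → Vertex → ℕ) (h : ∀ i v, ν i v = 0 ∨ ν i v = 2) (v : Vertex) :
    offspring ν v = 0 ∨ offspring ν v = 2 := by
  induction v generalizing ν with
  | nil => exact Or.inr rfl
  | cons j w ih =>
    rcases j with _ | _ | j
    · exact h 0 w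
    · exact ih _ fun i v => h (i + 1) v
    · exact Or.inl rfl

lemma isBinary_backboneTree (ν : ℕ → Vertex → ℕ) (h : ∀ i v, ν i v = 0 ∨ ν i v = 2) :
    IsBinary (backboneTree fun i => galtonWatson (ν i)) (offspring ν) :=
  ⟨nil_mem_backboneTree _, backboneTree_concat ν, offspring_eq ν h⟩

/-! ### Existence and uniqueness of the set of useful marks -/

/-- When deactivation is well founded, membership of a mark is determined by that of the marks which
can deactivate it. This is the uniqueness of the kernel of a well-founded directed graph. -/
lemma existsUnique_kernel {α : Type*} (M : Set α) (D : α → α → Prop)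
    (hwf : WellFounded fun a b => a ∈ M ∧ b ∈ M ∧ D a b) :
    ∃! U : Set α, ∀ m, m ∈ U ↔ m ∈ M ∧ ∀ m' ∈ U, ¬ D m' m := by
  obtain ⟨K, hK⟩ : ∃ K : α → Prop, ∀ b, K b ↔ ∀ a, a ∈ M ∧ b ∈ M ∧ D a b → ¬ K a := by
    refine ⟨hwf.fix fun b F => ∀ a (h : a ∈ M ∧ b ∈ M ∧ D a b), ¬ F a h, fun b => ?_⟩
    rw [hwf.fix_eq]
  refine ⟨{m | m ∈ M ∧ K m}, fun m => ?_, fun W hW => ?_⟩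
  · refine and_congr_right fun hm => ?_
    rw [hK]
    exact ⟨fun h m' hm' hD => h m' ⟨hm'.1, hm, hD⟩ hm'.2,
      fun h m' hm' hk => h m' ⟨hm'.1, hk⟩ hm'.2.2⟩
  · ext m
    induction m using hwf.induction with
    | _ m ih =>
      rw [hW]
      refine and_congr_right fun hm => ?_
      rw [hK]
      constructor
      · intro h a ha hk
        exact h a ((ih a ha).2 ⟨ha.1, hk⟩) ha.2.2
      · intro h a ha hD
        have haM := ((hW a).1 ha).1
        exact h a ⟨haM, hm, hD⟩ ((ih a ⟨haM, hm, hD⟩).1 ha).2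

/-- Predecessors remain in `F` and have larger `f`, so the number of elements of `F` above the
current value decreases strictly. -/
lemma acc_of_finite {α : Type*} {r : α → α → Prop} (f : α → ℝ) (hf : ∀ a b, r a b → f b < f a)
    {F : Set α} (hF : F.Finite) (hcl : ∀ a b, r a b → b ∈ F → a ∈ F) {b : α} (hb : b ∈ F) :
    Acc r b := by
  induction hk : {x ∈ F | f b < f x}.ncard using Nat.strong_induction_on generalizing b with
  | _ k ih =>
    refine ⟨b, fun a hab => ?_⟩
    refine ih _ ?_ (hcl a b hab hb) rfl
    rw [← hk]
    refine Set.ncard_lt_ncard ⟨fun x hx => ⟨hx.1, (hf a b hab).trans hx.2⟩, fun h => ?_⟩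
      (hF.subset fun x hx => hx.1)
    exact lt_irrefl _ (h ⟨hcl a b hab hb, hf a b hab⟩).2

/-! ### Marks crossing a backbone edge. -/

section Tree

variable {T : Set Vertex} {N : Vertex → ℕ} {κ : Vertex → ℝ} {π : Vertex → Set ℝ} {U : Set Mark}

/-- The mark `m` is sent from above the edge `spine j` to a point below this edge. -/
def Crosses (κ : Vertex → ℝ) (j : ℕ) (m : Mark) : Prop :=
  spine j <+: m.1 ∧ m.2 < bottom κ (spine j)

lemma not_crosses (hκ : ∀ v, 0 < κ v) {j : ℕ} {m : Mark} {y : Vertex} (hy : InEdge κ m y)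
    (hj : spine j <+: m.1) : ¬ Crosses κ j m ↔ spine j <+: y := by
  constructor
  · intro h
    rcases List.prefix_or_prefix_of_prefix hj hy.1 with h1 | h1
    · exact h1
    · by_cases hne : y = spine j
      · rw [hne]
      · exact absurd ⟨hj, hy.2.2.trans_le (height_le_bottom hκ h1 hne)⟩ h
  · rintro h ⟨-, h2⟩
    have h3 := hy.2.1
    by_cases hne : spine j = y
    · rw [hne] at h2; linarith
    · have h4 := height_le_bottom hκ h hne
      have h5 := hκ (spine j)
      rw [height_eq] at h4
      linarith

/-- If `spine j` sends a mark to the edge just below it, then this mark, as well as anything which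
deactivates it, deactivates the marks crossing this edge. -/
lemma exists_own_mark {j : ℕ} (hj : Hits κ π (spine j) [])
    (hT : spine j ∈ nodes T) : ∃ m₀ ∈ marks T κ π, m₀.1 = spine j ∧ InEdge κ m₀ (spine j) ∧
      ∀ m, Crosses κ j m → Deactivates κ m₀ m ∧ ∀ m', Deactivates κ m' m₀ → Deactivates κ m' m := by
  obtain ⟨h, hh, hI⟩ := hj
  rw [List.append_nil] at hh
  have hE : InEdge κ (spine j, h) (spine j) := ⟨List.prefix_refl _, hI⟩
  refine ⟨(spine j, h), ⟨hT, hh, _, hE⟩, rfl, hE, fun m hm => ?_⟩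
  have hlt : m.2 < h := hm.2.trans hI.1
  refine ⟨⟨hlt, _, hE, hm.1⟩, ?_⟩
  rintro m' ⟨h1, y, hy, hyx⟩
  exact ⟨hlt.trans h1, y, hy, hyx.trans hm.1⟩

/-- Either the own mark of `spine j` is useful and deactivates `m`, or a useful mark deactivates it
and then deactivates `m` as well. -/
lemma not_crosses_of_mem (hU : IsUsefulSet T κ π U) {j : ℕ} (hj : Hits κ π (spine j) [])
    (hT : spine j ∈ nodes T) {m : Mark} (hm : m ∈ U) : ¬ Crosses κ j m := by
  intro hc
  obtain ⟨m₀, h₀, -, -, hD⟩ := exists_own_mark hj hT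
  obtain ⟨h1, h2⟩ := hD m hc
  have hm' := ((hU m).1 hm).2
  by_cases h0 : m₀ ∈ U
  · exact hm' m₀ h0 h1
  · rw [hU] at h0
    push Not at h0
    obtain ⟨m', hm'U, hd⟩ := h0 h₀
    exact hm' m' hm'U (h2 m' hd)

/-- If above every backbone vertex there is one which sends a mark to the edge just below it, and
the marks sent from outside the subtrees above these vertices are finitely many, then the pruning
procedure makes sense. -/
lemma pruningWellDefined_of_forall_exists (hκ : ∀ v, 0 < κ v) (hs : ∀ j, spine j ∈ nodes T)
    (hcof : ∀ m ∈ marks T κ π, ∃ j, Hits κ π (spine j) [] ∧ ¬ spine j <+: m.1)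
    (hfin : ∀ j, Hits κ π (spine j) [] → {m ∈ marks T κ π | ¬ spine j <+: m.1}.Finite) :
    PruningWellDefined T κ π := by
  -- An edge may receive infinitely many marks from the infinite tree, so deactivation need not be
  -- well founded on all marks. The crossing marks are never useful; restricting the rule to the
  -- others gives the same solutions.
  set M : Set Mark := {m ∈ marks T κ π | ∀ j, Hits κ π (spine j) [] → ¬ Crosses κ j m} with hM
  have hwf : WellFounded fun a b => a ∈ M ∧ b ∈ M ∧ Deactivates κ a b := by
    refine ⟨fun b => ?_⟩
    by_cases hb : b ∈ M
    · obtain ⟨j, hj, hjb⟩ := hcof b hb.1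
      refine acc_of_finite (fun m : Mark => m.2) (fun a b h => h.2.2.1) (hfin j hj) ?_ ⟨hb.1, hjb⟩
      rintro a c ⟨ha, hc, -, y, hy, hyc⟩ ⟨-, hjc⟩
      refine ⟨ha.1, fun hja => hjc ?_⟩
      exact ((not_crosses hκ hy hja).1 (ha.2 j hj)).trans hyc
    · exact ⟨b, fun a ha => absurd ha.2.1 hb⟩
  have hequiv : ∀ U : Set Mark, IsUsefulSet T κ π U ↔
      ∀ m, m ∈ U ↔ m ∈ M ∧ ∀ m' ∈ U, ¬ Deactivates κ m' m := by
    intro U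
    constructor
    · intro hU m
      constructor
      · intro hm
        exact ⟨⟨((hU m).1 hm).1, fun j hj => not_crosses_of_mem hU hj (hs j) hm⟩, ((hU m).1 hm).2⟩
      · rintro ⟨h1, h2⟩
        exact (hU m).2 ⟨h1.1, h2⟩
    · intro hU m
      constructor
      · intro hm
        exact ⟨((hU m).1 hm).1.1, ((hU m).1 hm).2⟩
      · rintro ⟨h1, h2⟩
        refine (hU m).2 ⟨⟨h1, fun j hj hc => ?_⟩, h2⟩
        obtain ⟨m₀, h₀, hx, hE, hD⟩ := exists_own_mark hj (hs j)
        obtain ⟨h3, h4⟩ := hD m hc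
        -- The mark `m₀` lies in the edge `spine j`, so it cannot be below an edge `spine i` with
        -- `spine i` a prefix of `spine j`.
        have h₀M : m₀ ∈ M := by
          refine ⟨h₀, fun i _ hi => ?_⟩
          exact (not_crosses hκ hE hi.1).2 (hx ▸ hi.1) hi
        by_cases h0 : m₀ ∈ U
        · exact h2 m₀ h0 h3
        · rw [hU] at h0
          push Not at h0
          obtain ⟨m', hm'U, hd⟩ := h0 h₀M
          exact h2 m' hm'U (h4 m' hd)
  unfold PruningWellDefined
  simp only [hequiv]
  exact existsUnique_kernel M _ hwf

lemma pruningWellDefined_of_finite (hfin : (marks T κ π).Finite) : PruningWellDefined T κ π := by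
  refine existsUnique_kernel _ _ ⟨fun b => ?_⟩
  by_cases hb : b ∈ marks T κ π
  · exact acc_of_finite (fun m : Mark => m.2) (fun a b h => h.2.2.1) hfin
      (fun a b h _ => h.1) hb
  · exact ⟨b, fun a ha => absurd ha.2.1 hb⟩

/-! ### Truncation at a backbone vertex -/

lemma mem_nodes_truncate {x v : Vertex} :
    v ∈ nodes (truncate T x) ↔ v ∈ nodes T ∧ ¬ x <+: v := by
  constructor
  · rintro ⟨h1, j, h2⟩
    refine ⟨⟨h1.1, j, h2.1⟩, fun h => ?_⟩
    have h3 := h2.2 (h.trans (List.prefix_append _ _))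
    have h4 := h.length_le
    rw [h3] at h4
    simp at h4
  · rintro ⟨⟨h1, j, h2⟩, h3⟩
    refine ⟨⟨h1, fun h => absurd h h3⟩, j, h2, fun h => ?_⟩
    exact (List.prefix_concat_iff.1 h).resolve_right h3

lemma marks_truncate {x : Vertex} :
    marks (truncate T x) κ π = {m ∈ marks T κ π | ¬ x <+: m.1} := by
  ext m
  simp only [marks, Set.mem_ofPred_eq, mem_nodes_truncate]
  tauto

/-- A useful mark sent from at or above `spine j` lies in an edge at or above `spine j`, so it can
only deactivate marks sent from there. Dropping these marks does not affect the rule for the others.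
-/
lemma IsUsefulSet.truncate (hκ : ∀ v, 0 < κ v) (hU : IsUsefulSet T κ π U) {j : ℕ}
    (hj : Hits κ π (spine j) []) (hT : spine j ∈ nodes T) :
    IsUsefulSet (truncate T (spine j)) κ π {m ∈ U | ¬ spine j <+: m.1} := by
  intro m
  rw [marks_truncate]
  constructor
  · rintro ⟨h1, h2⟩
    exact ⟨⟨((hU m).1 h1).1, h2⟩, fun m' hm' => ((hU m).1 h1).2 m' hm'.1⟩
  · rintro ⟨⟨h1, h2⟩, h3⟩
    refine ⟨(hU m).2 ⟨h1, fun m' hm' hD => h3 m' ⟨hm', fun hjm => h2 ?_⟩ hD⟩, h2⟩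
    obtain ⟨-, y, hy, hym⟩ := hD
    exact ((not_crosses hκ hy hjm).1 (not_crosses_of_mem hU hj hT hm')).trans hym

/-- The edge `spine j` is cut, so cuts above it remove nothing more, and the cuts elsewhere come
from the same useful marks in both trees. -/
lemma prune_truncate (hκ : ∀ v, 0 < κ v) (hW : PruningWellDefined T κ π) {j : ℕ}
    (hj : Hits κ π (spine j) []) (hT : spine j ∈ nodes T)
    (hWj : PruningWellDefined (truncate T (spine j)) κ π) :
    prune T κ π = prune (truncate T (spine j)) κ π := by
  have hU := isUsefulSet_useful hW
  have hUj := useful_eq hWj (hU.truncate hκ hj hT)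
  ext v
  rw [mem_prune, mem_prune, hUj]
  constructor
  · rintro ⟨h1, h2⟩
    refine ⟨⟨h1, fun h => h2 _ ?_ h⟩, fun y ⟨m, hm, hy⟩ => h2 y ⟨m, hm.1, hy⟩⟩
    rw [isCut_iff hκ hU]
    refine ⟨[], by simpa using hT, hj, fun u h1 h2 => absurd (List.prefix_nil.1 h2) h1⟩
  · rintro ⟨h1, h2⟩
    refine ⟨h1.1, ?_⟩
    rintro y ⟨m, hm, hy⟩ hyv
    by_cases hjy : spine j <+: y
    · have h3 := h1.2 (hjy.trans hyv)
      rw [← h3] at hyv ⊢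
      exact hyv.eq_of_length_le hjy.length_le
    · exact h2 y ⟨m, ⟨hm, fun h => hjy ((not_crosses hκ hy h).1
        (not_crosses_of_mem hU hj hT hm))⟩, hy⟩ hyv

/-- An exploration with at most two children per vertex, stopped at `Q` within `d` generations,
visits finitely many vertices. -/
lemma finite_of_terminates (hT : IsBinary T N) {Q : Vertex → Prop} {d : ℕ} {v : Vertex}
    (h : Terminates Q d v) :
    {w | w ∈ T ∧ v <+: w ∧ ∀ u, v <+: u → u <+: w → u ≠ w → ¬ Q u}.Finite := by
  induction d generalizing v with
  | zero =>
    refine (Set.finite_singleton v).subset ?_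
    rintro w ⟨-, h1, h2⟩
    by_contra hne
    exact h2 v (List.prefix_refl _) h1 (fun h => hne h.symm) h
  | succ d ih =>
    rcases h with h | h
    · refine (Set.finite_singleton v).subset ?_
      rintro w ⟨-, h1, h2⟩
      by_contra hne
      exact h2 v (List.prefix_refl _) h1 (fun h => hne h.symm) h
    · refine ((Set.finite_singleton v).union ((ih h.1).union (ih h.2))).subset ?_
      rintro w ⟨h0, ⟨z, rfl⟩, h2⟩
      rcases z with _ | ⟨j, z⟩
      · left; simp
      · rw [List.append_cons v j z] at h0 h2 ⊢
        have hj := ((hT.child v j).1 (hT.mem_of_append h0)).2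
        have h3 : ∀ u, v ++ [j] <+: u → u <+: v ++ [j] ++ z → u ≠ v ++ [j] ++ z → ¬ Q u :=
          fun u hu => h2 u ((List.prefix_append _ _).trans hu)
        have := hT.two v
        have hj : j = 0 ∨ j = 1 := by omega
        right
        rcases hj with rfl | rfl
        · left
          exact ⟨h0, List.prefix_append _ _, h3⟩
        · right
          exact ⟨h0, List.prefix_append _ _, h3⟩

lemma terminates_spine {Q : Vertex → Prop} {j : ℕ} (hj : Q (spine j))
    (h : ∀ i, ∃ d, Terminates Q d (spine i ++ [0])) : ∃ d, Terminates Q d [] := by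
  -- Descent along the backbone from `spine j`; each step takes a depth sufficient for both the
  -- planted tree and the backbone side.
  have : ∀ i ≤ j, ∃ d, Terminates Q d (spine (j - i)) := by
    intro i
    induction i with
    | zero => exact fun _ => ⟨0, hj⟩
    | succ i ih =>
      intro hi
      obtain ⟨d, hd⟩ := ih (by omega)
      obtain ⟨d', hd'⟩ := h (j - (i + 1))
      refine ⟨max d' d + 1, Or.inr ⟨hd'.le (le_max_left _ _), ?_⟩⟩
      rw [spine_concat, show j - (i + 1) + 1 = j - i by omega]
      exact hd.le (le_max_right _ _)
  simpa [spine] using this j le_rfl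

end Tree

/-! ### Regular inputs -/

/-- The properties of the input, valid almost surely, from which the pruning is defined. -/
structure IsRegular (ν : ℕ → Vertex → ℕ) (κ : Vertex → ℝ) (π : Vertex → Set ℝ) : Prop where
  offspring_eq : ∀ i v, ν i v = 0 ∨ ν i v = 2
  length_pos : ∀ v, 0 < κ v
  finite : ∀ v (r : ℕ), (π v ∩ Set.Ioo 0 (r : ℝ)).Finite
  extinct : ∀ i, ∃ d, Terminates (fun v => offspring ν v ≠ 2) d (spine i ++ [0])
  own_mark : ∀ i, ∃ j ≥ i, Hits κ π (spine j) []

namespace IsRegular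

variable {ν : ℕ → Vertex → ℕ} {κ : Vertex → ℝ} {π : Vertex → Set ℝ}

lemma isBinary (h : IsRegular ν κ π) :
    IsBinary (backboneTree fun i => galtonWatson (ν i)) (offspring ν) :=
  isBinary_backboneTree ν h.offspring_eq

lemma spine_mem_nodes (h : IsRegular ν κ π) (j : ℕ) :
    spine j ∈ nodes (backboneTree fun i => galtonWatson (ν i)) :=
  h.isBinary.mem_nodes.2 ⟨Or.inl ⟨j, rfl⟩, offspring_spine ν j⟩

/-- Exploration stops at `spine j` on the backbone and at childless vertices in the planted trees,
which are extinct. -/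
lemma finite_truncate (h : IsRegular ν κ π) (j : ℕ) :
    (truncate (backboneTree fun i => galtonWatson (ν i)) (spine j)).Finite := by
  obtain ⟨d, hd⟩ := terminates_spine (Q := fun v => offspring ν v ≠ 2 ∨ v = spine j)
    (Or.inr rfl) fun i => (h.extinct i).imp fun d hd => hd.mono fun v hv => Or.inl hv
  refine (finite_of_terminates h.isBinary hd).subset ?_
  rintro w ⟨hw, hj⟩
  refine ⟨hw, List.nil_prefix, ?_⟩
  rintro u - ⟨z, rfl⟩ hne
  rcases z with _ | ⟨i, z⟩
  · simp at hne
  · rintro (hu | rfl)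
    · have hc := ((h.isBinary.child u i).1
        (h.isBinary.mem_of_append (by rw [List.append_cons] at hw; exact hw))).2
      have := h.isBinary.two u
      omega
    · exact hne (hj (List.prefix_append _ _))

lemma finite_marks_truncate (h : IsRegular ν κ π) (j : ℕ) :
    (marks (truncate (backboneTree fun i => galtonWatson (ν i)) (spine j)) κ π).Finite := by
  refine ((h.finite_truncate j).biUnion fun x _ => ?_ :
    (⋃ x ∈ truncate (backboneTree fun i => galtonWatson (ν i)) (spine j),
      ({x} : Set Vertex) ×ˢ (π x ∩ Set.Ioo 0 ((⌈height κ x⌉₊ : ℕ) : ℝ))).Finite).subset ?_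
  · exact (Set.finite_singleton x).prod (h.finite x _)
  · rintro ⟨x, t⟩ ⟨h1, h2, y, hy⟩
    simp only [Set.mem_iUnion]
    refine ⟨x, h1.1, rfl, h2, (bottom_nonneg h.length_pos y).trans_lt hy.2.1, ?_⟩
    obtain ⟨z, rfl⟩ := hy.1
    exact hy.2.2.trans_le ((height_le_height_append h.length_pos y z).trans (Nat.le_ceil _))

lemma pruningWellDefined_truncate (h : IsRegular ν κ π) (j : ℕ) :
    PruningWellDefined (truncate (backboneTree fun i => galtonWatson (ν i)) (spine j)) κ π :=
  pruningWellDefined_of_finite (h.finite_marks_truncate j)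

lemma pruningWellDefined (h : IsRegular ν κ π) :
    PruningWellDefined (backboneTree fun i => galtonWatson (ν i)) κ π := by
  refine pruningWellDefined_of_forall_exists h.length_pos h.spine_mem_nodes ?_ ?_
  · intro m _
    -- A backbone vertex longer than the sender cannot be its prefix.
    obtain ⟨j, hj, hh⟩ := h.own_mark (m.1.length + 1)
    refine ⟨j, hh, fun hp => ?_⟩
    have := hp.length_le
    rw [length_spine] at this
    omega
  · intro j _
    rw [← marks_truncate]
    exact h.finite_marks_truncate j

/-- The pruned tree is given by the recursion `alive`, run from any sufficiently large depth. -/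
lemma exists_alive (h : IsRegular ν κ π) : ∃ d₀, ∀ d ≥ d₀,
    (prune (backboneTree fun i => galtonWatson (ν i)) κ π).Finite ∧
    (leaves (prune (backboneTree fun i => galtonWatson (ν i)) κ π)).ncard =
      (alive (offspring ν) (Hits κ π) d []).card + 1 := by
  obtain ⟨j, -, hj⟩ := h.own_mark 0
  obtain ⟨d₀, hd₀⟩ := terminates_spine (Q := fun v => offspring ν v ≠ 2 ∨ Hits κ π v [])
    (Or.inr hj) fun i => (h.extinct i).imp fun d hd => hd.mono fun v hv => Or.inl hv
  refine ⟨d₀, fun d hd => ?_⟩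
  exact finite_prune_and_ncard_leaves h.isBinary (coe_alive_eq h.isBinary h.length_pos
    (isUsefulSet_useful h.pruningWellDefined) (hd₀.le hd) h.isBinary.root)

end IsRegular
/-! ### Independence of the marks sent to different edges -/

-- Multiplying the density of rate 2 by exp(-s x) gives 2/(2+s) times the density of rate 2+s.
open scoped ENNReal in
lemma lintegral_exp_neg_mul_expMeasure {s : ℝ} (hs : 0 ≤ s) :
    ∫⁻ x, ENNReal.ofReal (Real.exp (-(s * x))) ∂(expMeasure 2) = ENNReal.ofReal (2 / (2 + s)) := by
  have h : expMeasure 2 = volume.withDensity (exponentialPDF 2) := rfl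
  have hm : ∀ r, Measurable (exponentialPDF r) := fun r =>
    (measurable_exponentialPDFReal r).ennreal_ofReal
  rw [h, lintegral_withDensity_eq_lintegral_mul _ (hm 2) (by fun_prop)]
  have : ∀ x, (exponentialPDF 2 * fun x => ENNReal.ofReal (Real.exp (-(s * x)))) x =
      ENNReal.ofReal (2 / (2 + s)) * exponentialPDF (2 + s) x := by
    intro x
    rw [Pi.mul_apply, exponentialPDF_eq, exponentialPDF_eq]
    split_ifs with hx
    · rw [← ENNReal.ofReal_mul (by positivity), ← ENNReal.ofReal_mul (by positivity)]
      congr 1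
      rw [show -((2 + s) * x) = -(2 * x) + -(s * x) by ring, Real.exp_add]
      field_simp
    · simp
  simp_rw [this]
  rw [lintegral_const_mul _ (hm _), lintegral_exponentialPDF_eq_one (by positivity), mul_one]

lemma expMeasure_Iic_zero : expMeasure 2 (Set.Iic 0) = 0 := by
  have : IsProbabilityMeasure (expMeasure 2) := isProbabilityMeasure_expMeasure two_pos
  rw [← ofReal_cdf, cdf_expMeasure_eq two_pos]
  simp

/-- The vertex `y ++ z` sends a mark to the part in `(0, ∞)` of the edge `y`. -/
def PosHits (κ : Vertex → ℝ) (π : Vertex → Set ℝ) (y z : Vertex) : Prop :=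
  (π (y ++ z) ∩ Set.Ioo (max 0 (bottom κ y)) (height κ y)).Nonempty

/-- The law of the points is prescribed on (0, ∞) only. `PosHits` stays inside this half-line for
every outcome, hence is measurable everywhere, and the truncation at 0 is invisible once the lengths
are positive. -/
lemma posHits_eq_hits {κ : Vertex → ℝ} (hκ : ∀ v, 0 < κ v) (π : Vertex → Set ℝ) :
    PosHits κ π = Hits κ π := by
  funext y z
  rw [PosHits, Hits, max_eq_right (bottom_nonneg hκ y)]

/-- The intervals with rational endpoints which contain points of `π v ∩ (0, ∞)`. -/
def ratPoints (π : Vertex → Set ℝ) (v : Vertex) (q r : ℚ) : Prop :=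
  (π v ∩ Set.Ioo (max 0 (q : ℝ)) r).Nonempty

/-- `PosHits` in terms of `ratPoints`. -/
def RatHits (κ : Vertex → ℝ) (φ : Vertex → ℚ → ℚ → Prop) (y z : Vertex) : Prop :=
  ∃ q r : ℚ, bottom κ y < q ∧ r < height κ y ∧ φ (y ++ z) q r

/-- Rational intervals suffice to detect a point in an open interval. The hits thus become a
measurable function of the lengths and of a countable encoding of the points, to which Fubini
applies. -/
lemma ratHits_ratPoints (κ : Vertex → ℝ) (π : Vertex → Set ℝ) (y z : Vertex) :
    RatHits κ (ratPoints π) y z ↔ PosHits κ π y z := by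
  constructor
  · rintro ⟨q, r, hq, hr, h, hh, h1, h2⟩
    exact ⟨h, hh, (max_le_max le_rfl hq.le).trans_lt h1, h2.trans hr⟩
  · rintro ⟨h, hh, h1, h2⟩
    obtain ⟨q, hq, hq'⟩ := exists_rat_btwn ((le_max_right _ _).trans_lt h1)
    obtain ⟨r, hr, hr'⟩ := exists_rat_btwn h2
    exact ⟨q, r, hq, hr', h, hh, max_lt ((le_max_left _ _).trans_lt h1) hq', hr⟩

lemma measurable_ratHits (y z : Vertex) :
    Measurable fun p : (Vertex → ℝ) × (Vertex → ℚ → ℚ → Prop) => RatHits p.1 p.2 y z := by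
  have hb : Measurable fun p : (Vertex → ℝ) × (Vertex → ℚ → ℚ → Prop) => bottom p.1 y := by
    unfold bottom
    fun_prop
  have hh : Measurable fun p : (Vertex → ℝ) × (Vertex → ℚ → ℚ → Prop) => height p.1 y := by
    unfold height
    fun_prop
  unfold RatHits
  refine Measurable.exists fun q => Measurable.exists fun r => ?_
  refine (measurableSet_setOfPred.1 (measurableSet_lt hb measurable_const)).and
    ((measurableSet_setOfPred.1 (measurableSet_lt measurable_const hh)).and ?_)
  fun_prop

lemma measurableSet_inter_eq_empty {Ω : Type*} (N : Ω → Set ℝ) {B : Set ℝ}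
    (hB : MeasurableSet B) (h0 : B ⊆ Set.Ioi 0) :
    MeasurableSet[pointSigma N] {ω | N ω ∩ B = ∅} := by
  have h1 : MeasurableSpace.comap (fun ω => (N ω ∩ B).encard) ⊤ ≤ pointSigma N :=
    le_iSup_of_le B (le_iSup_of_le hB (le_iSup_of_le h0 le_rfl))
  have h2 : MeasurableSet[pointSigma N] {ω | (N ω ∩ B).encard = 0} :=
    h1 _ ⟨{0}, trivial, rfl⟩
  simpa only [Set.encard_eq_zero] using h2

lemma measurable_nonempty_inter {Ω : Type*} (N : Ω → Set ℝ) {B : Set ℝ} (hB : MeasurableSet B)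
    (h0 : B ⊆ Set.Ioi 0) : Measurable[pointSigma N] fun ω => (N ω ∩ B).Nonempty := by
  refine (@measurableSet_setOfPred _ (pointSigma N) _).1 ?_
  convert (measurableSet_inter_eq_empty N hB h0).compl using 1
  ext ω
  simp [Set.nonempty_iff_ne_empty]

lemma measurable_ratPoints {Ω : Type*} [m : MeasurableSpace Ω] (π : Vertex → Ω → Set ℝ)
    (h : ∀ v, pointSigma (π v) ≤ m) : Measurable fun ω => ratPoints fun v => π v ω := by
  refine measurable_pi_iff.2 fun v => measurable_pi_iff.2 fun q => measurable_pi_iff.2 fun r => ?_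
  refine Measurable.mono (measurable_nonempty_inter (π v) measurableSet_Ioo fun x hx => ?_)
    (h v) le_rfl
  exact (le_max_left _ _).trans_lt hx.1

/-! ### Joint law of the marks sent to finitely many edges. -/

section Input

variable {Ω : Type*} [mΩ : MeasurableSpace Ω] {P : Measure Ω} {n : ℕ}
  {ν : ℕ → Vertex → Ω → ℕ} {κ : Vertex → Ω → ℝ} {π : Vertex → Ω → Set ℝ}

lemma IsPoissonPointProcess.measure_inter_eq_empty {r : ℝ≥0} {N : Ω → Set ℝ}
    (h : IsPoissonPointProcess P r N) {B : Set ℝ} (hB : MeasurableSet B) (h0 : B ⊆ Set.Ioi 0)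
    (hv : volume B ≠ ⊤) :
    P {ω | N ω ∩ B = ∅} = ENNReal.ofReal (Real.exp (-(r * (volume B).toReal))) := by
  have := h.count_law B hB h0 hv 0
  simp only [Nat.cast_zero, Set.encard_eq_zero] at this
  rw [this, poissonMeasure_singleton]
  simp [ENNReal.toReal]

namespace IsInput

lemma inputSigma_le (h : IsInput P n ν κ π) (i) : inputSigma ν κ π i ≤ mΩ := by
  rcases i with p | v | v
  · exact (h.measurable_offspring _ _).comap_le
  · exact (h.measurable_length _).comap_le
  · refine iSup_le fun B => iSup_le fun hB => iSup_le fun h0 => ?_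
    rintro s ⟨t, -, rfl⟩
    exact ((h.poisson v).measurable_count B hB h0) (MeasurableSet.of_discrete)

lemma ae_length_pos (h : IsInput P n ν κ π) : ∀ᵐ ω ∂P, ∀ v, 0 < κ v ω := by
  rw [ae_all_iff]
  intro v
  have h1 : P (κ v ⁻¹' Set.Iic 0) = 0 := by
    rw [← Measure.map_apply (h.measurable_length v) measurableSet_Iic, h.length_law,
      expMeasure_Iic_zero]
  filter_upwards [measure_eq_zero_iff_ae_notMem.1 h1] with ω hω
  simpa using hω

lemma measurable_lengths (h : IsInput P n ν κ π) : Measurable fun ω v => κ v ω :=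
  measurable_pi_iff.2 h.measurable_length

lemma measurable_ratPoints (h : IsInput P n ν κ π) :
    Measurable fun ω => ratPoints fun v => π v ω :=
  ForestFire.measurable_ratPoints π fun v => h.inputSigma_le (.inr (.inr v))

lemma indepFun_lengths_ratPoints (h : IsInput P n ν κ π) :
    IndepFun (fun ω v => κ v ω) (fun ω => ratPoints fun v => π v ω) P := by
  have hd : Disjoint (Set.range fun v : Vertex => (.inr (.inl v) : (ℕ × Vertex) ⊕ Vertex ⊕ Vertex))
      (Set.range fun v : Vertex => .inr (.inr v)) := by
    rw [Set.disjoint_left]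
    rintro _ ⟨v, rfl⟩ ⟨w, hw⟩
    simp at hw
  have := indep_iSup_of_disjoint h.inputSigma_le h.indep hd
  rw [iSup_range, iSup_range] at this
  rw [IndepFun_iff_Indep]
  refine indep_of_indep_of_le_right (indep_of_indep_of_le_left this ?_)
    (ForestFire.measurable_ratPoints (m := ⨆ v, pointSigma (π v)) π
      fun v => le_iSup (fun v => pointSigma (π v)) v).comap_le
  refine Measurable.comap_le ?_
  refine (@measurable_pi_iff Ω Vertex (fun _ => ℝ) (⨆ v, inputSigma ν κ π (.inr (.inl v))) _ _).2
    fun v => ?_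
  exact Measurable.mono (comap_measurable (κ v))
    (le_iSup (fun v => inputSigma ν κ π (.inr (.inl v))) v) le_rfl

/-- For deterministic edge lengths, the marks sent to the various edges are independent. -/
lemma measure_forall_inter_eq_empty (h : IsInput P n ν κ π) {k : Vertex → ℝ} (hk : ∀ v, 0 < k v)
    (Y : Finset Vertex) (S : Vertex → Finset Vertex) :
    P {ω | ∀ y ∈ Y, ∀ z ∈ S y, ¬ PosHits k (fun v => π v ω) y z} =
      ∏ y ∈ Y, ENNReal.ofReal (Real.exp (-((S y).card / n * k y))) := by
  classical
  set I : Vertex → Set ℝ := fun y => Set.Ioo (max 0 (bottom k y)) (height k y) with hI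
  have hI' : ∀ y, I y = Set.Ioo (bottom k y) (height k y) := fun y => by
    rw [hI]; simp only; rw [max_eq_right (bottom_nonneg hk y)]
  -- The conditions are regrouped by sender: `F x` is the set of edges that `x` must miss and `B x`
  -- the region they occupy on its branch.
  set X : Finset Vertex := Y.biUnion fun y => (S y).image (y ++ ·) with hX
  set F : Vertex → Finset Vertex := fun x => Y.filter fun y => x ∈ (S y).image (y ++ ·) with hF
  set B : Vertex → Set ℝ := fun x => ⋃ y ∈ F x, I y with hB
  have hBm : ∀ x, MeasurableSet (B x) := fun x =>
    Finset.measurableSet_biUnion _ fun y _ => measurableSet_Ioo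
  have hB0 : ∀ x, B x ⊆ Set.Ioi 0 := by
    intro x t ht
    simp only [hB, Set.mem_iUnion] at ht
    obtain ⟨y, -, hy⟩ := ht
    exact (le_max_left _ _).trans_lt hy.1
  have hBv : ∀ x, volume (B x) = ENNReal.ofReal (∑ y ∈ F x, k y) := by
    intro x
    rw [ENNReal.ofReal_sum_of_nonneg fun y _ => (hk y).le, hB]
    simp only
    rw [measure_biUnion_finset _ fun y _ => measurableSet_Ioo]
    · refine Finset.sum_congr rfl fun y _ => ?_
      have := hI' y
      simp only [hI] at this
      rw [this, Real.volume_Ioo, height_eq]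
      congr 1
      ring
    -- Both edges lie on the branch below `x`, so they occupy disjoint intervals of distances.
    · intro y hy y' hy' hne
      rw [Function.onFun, Set.disjoint_left]
      intro t ht ht'
      have e := hI' y
      have e' := hI' y'
      simp only [hI] at e e'
      rw [e] at ht
      rw [e'] at ht'
      simp only [hF, Finset.coe_filter, Set.mem_ofPred_eq, Finset.mem_image] at hy hy'
      obtain ⟨-, z, -, hz⟩ := hy
      obtain ⟨-, z', -, hz'⟩ := hy'
      have h1 : y <+: x := ⟨z, hz⟩
      have h2 : y' <+: x := ⟨z', hz'⟩
      rcases List.prefix_or_prefix_of_prefix h1 h2 with h3 | h3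
      · have := height_le_bottom hk h3 hne
        linarith [ht.2, ht'.1]
      · have := height_le_bottom hk h3 (Ne.symm hne)
        linarith [ht.1, ht'.2]
  have hset : {ω | ∀ y ∈ Y, ∀ z ∈ S y, ¬ PosHits k (fun v => π v ω) y z} =
      ⋂ x ∈ X, {ω | π x ω ∩ B x = ∅} := by
    ext ω
    simp only [Set.mem_ofPred_eq, Set.mem_iInter]
    constructor
    · intro H x _
      rw [Set.eq_empty_iff_forall_notMem]
      rintro t ⟨ht, htB⟩
      simp only [hB, hF, Set.mem_iUnion, Finset.mem_filter, Finset.mem_image] at htB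
      obtain ⟨y, ⟨hy, z, hz, rfl⟩, hty⟩ := htB
      exact H y hy z hz ⟨t, ht, hty⟩
    · rintro H y hy z hz ⟨t, ht, hty⟩
      have hx : y ++ z ∈ X := Finset.mem_biUnion.2 ⟨y, hy, Finset.mem_image_of_mem _ hz⟩
      have := H _ hx
      rw [Set.eq_empty_iff_forall_notMem] at this
      refine this t ⟨ht, ?_⟩
      simp only [hB, hF, Set.mem_iUnion, Finset.mem_filter]
      exact ⟨y, ⟨hy, Finset.mem_image_of_mem _ hz⟩, hty⟩
  have hind : iIndep (fun v => inputSigma ν κ π (.inr (.inr v))) P :=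
    h.indep.precomp (g := fun v : Vertex => (.inr (.inr v) : (ℕ × Vertex) ⊕ Vertex ⊕ Vertex))
      fun v w h => by simpa using h
  rw [hset, hind.meas_biInter]
  · have hx : ∀ x ∈ X, P {ω | π x ω ∩ B x = ∅} =
        ENNReal.ofReal (Real.exp (∑ y ∈ F x, -(1 / n * k y))) := by
      intro x _
      rw [(h.poisson x).measure_inter_eq_empty (hBm x) (hB0 x) (by simp [hBv]), hBv,
        ENNReal.toReal_ofReal (Finset.sum_nonneg fun y _ => (hk y).le), Finset.mul_sum,
        ← Finset.sum_neg_distrib]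
      simp
    rw [Finset.prod_congr rfl hx, ← ENNReal.ofReal_prod_of_nonneg fun _ _ => (Real.exp_pos _).le,
      ← ENNReal.ofReal_prod_of_nonneg fun _ _ => (Real.exp_pos _).le, ← Real.exp_sum,
      ← Real.exp_sum]
    congr 2
    rw [Finset.sum_comm' (t' := Y) (s' := fun y => (S y).image (y ++ ·))]
    · refine Finset.sum_congr rfl fun y _ => ?_
      rw [Finset.sum_const, Finset.card_image_of_injective _ (List.append_right_injective y),
        nsmul_eq_mul]
      ring
    · intro x y
      simp only [hX, hF, Finset.mem_biUnion, Finset.mem_filter]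
      tauto
  · exact fun x _ => measurableSet_inter_eq_empty (π x) (hBm x) (hB0 x)

/-- The marks sent to the various edges are independent. -/
lemma measure_forall_not_posHits (h : IsInput P n ν κ π) [IsProbabilityMeasure P]
    (Y : Finset Vertex) (S : Vertex → Finset Vertex) :
    P {ω | ∀ y ∈ Y, ∀ z ∈ S y, ¬ PosHits (fun v => κ v ω) (fun v => π v ω) y z} =
      ∏ y ∈ Y, ENNReal.ofReal (2 / (2 + (S y).card / n)) := by
  set D : Set ((Vertex → ℝ) × (Vertex → ℚ → ℚ → Prop)) :=
    {p | ∀ y ∈ Y, ∀ z ∈ S y, ¬ RatHits p.1 p.2 y z} with hD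
  have hDm : MeasurableSet D := by
    refine Measurable.setOf ?_
    refine Measurable.forall fun y => measurable_const.imp ?_
    refine Measurable.forall fun z => measurable_const.imp (measurable_ratHits y z).not
  have h1 : P {ω | ∀ y ∈ Y, ∀ z ∈ S y, ¬ PosHits (fun v => κ v ω) (fun v => π v ω) y z} =
      P.map (fun ω => ((fun v => κ v ω), ratPoints fun v => π v ω)) D := by
    rw [Measure.map_apply (h.measurable_lengths.prodMk h.measurable_ratPoints) hDm]
    congr 1
    ext ω
    simp [hD, ratHits_ratPoints]
  have hm := h.measurable_lengths
  have hm' := h.measurable_ratPoints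
  have : IsProbabilityMeasure (P.map fun ω => ratPoints fun v => π v ω) :=
    Measure.isProbabilityMeasure_map hm'.aemeasurable
  rw [h1, h.indepFun_lengths_ratPoints.map_prod_eq_prod_map_map hm.aemeasurable hm'.aemeasurable,
    Measure.prod_apply hDm, lintegral_map (measurable_measure_prodMk_left hDm) hm]
  -- Given the lengths, each edge contributes a factor involving its own length only, although its
  -- position depends on the lengths below. This is why the product survives integration.
  have h2 : ∀ᵐ ω ∂P, (P.map fun ω => ratPoints fun v => π v ω)
      (Prod.mk (fun v => κ v ω) ⁻¹' D) =
      ∏ y ∈ Y, ENNReal.ofReal (Real.exp (-((S y).card / n * κ y ω))) := by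
    filter_upwards [h.ae_length_pos] with ω hω
    rw [Measure.map_apply hm' (measurable_prodMk_left hDm),
      ← h.measure_forall_inter_eq_empty hω Y S]
    congr 1
    ext ω
    simp [hD, ratHits_ratPoints]
  rw [lintegral_congr_ae h2]
  have hind : iIndepFun (fun v ω => κ v ω) P := by
    rw [iIndepFun_iff_iIndep]
    exact h.indep.precomp (g := fun v : Vertex => .inr (.inl v)) fun v w h => by simpa using h
  have hexp : ∀ y, Measurable fun x : ℝ => ENNReal.ofReal (Real.exp (-((S y).card / n * x))) := by
    intro y
    fun_prop
  rw [lintegral_prod_eq_prod_lintegral_of_indepFun Y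
    (fun y ω => ENNReal.ofReal (Real.exp (-((S y).card / n * κ y ω)))) (hind.comp _ hexp)
    fun y => (hexp y).comp (h.measurable_length y)]
  refine Finset.prod_congr rfl fun y _ => ?_
  rw [← lintegral_map (f := fun x => ENNReal.ofReal (Real.exp (-((S y).card / n * x))))
    (hexp y) (h.measurable_length y), h.length_law,
    lintegral_exp_neg_mul_expMeasure (by positivity)]

end IsInput
end Input
/-! ### The independent building blocks of the pruned tree -/

lemma offspring_cases (v : Vertex) :
    (∃ i, v = spine i) ∨ (∃ i w, v = spine i ++ 0 :: w) ∨ ∀ ν, offspring ν v = 0 := by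
  induction v with
  | nil => exact Or.inl ⟨0, rfl⟩
  | cons j w ih =>
    rcases j with _ | _ | j
    · exact Or.inr (Or.inl ⟨0, w, rfl⟩)
    · rcases ih with ⟨i, rfl⟩ | ⟨i, u, rfl⟩ | h
      · exact Or.inl ⟨i + 1, rfl⟩
      · exact Or.inr (Or.inl ⟨i + 1, u, rfl⟩)
      · exact Or.inr (Or.inr fun ν => h _)
    · exact Or.inr (Or.inr fun ν => rfl)

/-- The index of the building blocks: offspring numbers of the planted trees, and edges. -/
abbrev BlockIndex := (ℕ × Vertex) ⊕ Vertex

/-- The vertex to which a building block is attached. -/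
def blockVertex : BlockIndex → Vertex
  | .inl p => spine p.1 ++ 0 :: p.2
  | .inr y => y

/-- The building blocks attached to the vertices above `v`. -/
def blocksAbove (v : Vertex) : Set BlockIndex := {i | v <+: blockVertex i}

/-- The offspring number of `v`, if any. -/
def offspringBlock (v : Vertex) : Set BlockIndex := {i | ∃ p, i = .inl p ∧ blockVertex i = v}

lemma blocksAbove_mono {v w : Vertex} (h : v <+: w) : blocksAbove w ⊆ blocksAbove v :=
  fun _ hi => h.trans hi

lemma offspringBlock_subset (v : Vertex) : offspringBlock v ⊆ blocksAbove v := by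
  rintro i ⟨p, -, h⟩
  rw [blocksAbove, Set.mem_ofPred_eq, h]

lemma disjoint_blocksAbove (v : Vertex) :
    Disjoint (blocksAbove (v ++ [0])) (blocksAbove (v ++ [1])) := by
  rw [Set.disjoint_left]
  intro i h0 h1
  have := List.prefix_of_prefix_length_le h0 h1 (by simp)
  have := this.eq_of_length (by simp)
  simp at this

lemma disjoint_blocksAbove_offspringBlock (v : Vertex) :
    Disjoint (blocksAbove (v ++ [0]) ∪ blocksAbove (v ++ [1])) (offspringBlock v) := by
  rw [Set.disjoint_left]
  rintro i h ⟨p, -, rfl⟩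
  rcases h with h | h <;>
  · have := List.IsPrefix.length_le h
    simp at this

lemma disjoint_edgeBlock (v : Vertex) :
    Disjoint ((blocksAbove (v ++ [0]) ∪ blocksAbove (v ++ [1])) ∪ offspringBlock v)
      {(.inr v : BlockIndex)} := by
  rw [Set.disjoint_singleton_right]
  rintro ((h | h) | ⟨p, h, -⟩)
  · have := List.IsPrefix.length_le h
    simp [blockVertex] at this
  · have := List.IsPrefix.length_le h
    simp [blockVertex] at this
  · simp at h

/-! ### The σ-algebras of the building blocks. -/

section Blocks

variable {Ω : Type*} {ν : ℕ → Vertex → Ω → ℕ} {κ : Vertex → Ω → ℝ} {π : Vertex → Ω → Set ℝ}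

/-- None of the vertices `y ++ z`, `z ∈ S`, sends a mark to the edge `y`. -/
def noHits (κ : Vertex → Ω → ℝ) (π : Vertex → Ω → Set ℝ) (y : Vertex) (S : Finset Vertex) :
    Set Ω :=
  {ω | ∀ z ∈ S, ¬ PosHits (fun v => κ v ω) (fun v => π v ω) y z}

/-- The `σ`-algebras generated by the offspring numbers, and by the traces on each edge of the
marks sent to this edge. -/
@[reducible] def blockSigma (ν : ℕ → Vertex → Ω → ℕ) (κ : Vertex → Ω → ℝ) (π : Vertex → Ω → Set ℝ) :
    BlockIndex → MeasurableSpace Ω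
  | .inl p => MeasurableSpace.comap (ν p.1 p.2) inferInstance
  | .inr y => MeasurableSpace.generateFrom (Set.range (noHits κ π y))

/-- The `σ`-algebra generated by the building blocks in `S`. -/
@[reducible] def blocksSigma (ν : ℕ → Vertex → Ω → ℕ) (κ : Vertex → Ω → ℝ) (π : Vertex → Ω → Set ℝ)
    (S : Set BlockIndex) : MeasurableSpace Ω :=
  ⨆ i ∈ S, blockSigma ν κ π i

lemma blockSigma_le_blocksSigma {S : Set BlockIndex} {i : BlockIndex} (hi : i ∈ S) :
    blockSigma ν κ π i ≤ blocksSigma ν κ π S :=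
  le_iSup₂_of_le i hi le_rfl

lemma blocksSigma_mono {S S' : Set BlockIndex} (h : S ⊆ S') :
    blocksSigma ν κ π S ≤ blocksSigma ν κ π S' :=
  biSup_mono h

lemma isPiSystem_noHits (κ : Vertex → Ω → ℝ) (π : Vertex → Ω → Set ℝ) (y : Vertex) :
    IsPiSystem (Set.range (noHits κ π y)) := by
  classical
  rintro _ ⟨S, rfl⟩ _ ⟨S', rfl⟩ -
  refine ⟨S ∪ S', ?_⟩
  ext ω
  simp only [noHits, Finset.mem_union, Set.mem_ofPred_eq, Set.mem_inter_iff]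
  constructor
  · exact fun h => ⟨fun z hz => h z (Or.inl hz), fun z hz => h z (Or.inr hz)⟩
  · rintro ⟨h, h'⟩ z (hz | hz)
    exacts [h z hz, h' z hz]

lemma measurable_posHits_blockSigma (y z : Vertex) :
    Measurable[blockSigma ν κ π (.inr y)]
      fun ω => PosHits (fun v => κ v ω) (fun v => π v ω) y z := by
  refine (@measurableSet_setOfPred _ (blockSigma ν κ π (.inr y)) _).1 ?_
  have : MeasurableSet[blockSigma ν κ π (.inr y)] (noHits κ π y {z}) :=
    MeasurableSpace.measurableSet_generateFrom ⟨{z}, rfl⟩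
  convert this.compl using 1
  ext ω
  simp [noHits]

lemma measurable_offspring (v : Vertex) :
    Measurable[blocksSigma ν κ π (offspringBlock v)]
      fun ω => offspring (fun i u => ν i u ω) v := by
  rcases offspring_cases v with ⟨i, rfl⟩ | ⟨i, w, rfl⟩ | h
  · simp only [offspring_spine]
    exact measurable_const
  · simp only [offspring_planted]
    refine Measurable.mono (comap_measurable (ν i w)) ?_ le_rfl
    exact blockSigma_le_blocksSigma (ν := ν) (κ := κ) (π := π) (i := .inl (i, w))
      ⟨(i, w), rfl, rfl⟩
  · simp only [h]
    exact measurable_const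

end Blocks

section Input

variable {Ω : Type*} [mΩ : MeasurableSpace Ω] {P : Measure Ω} {n : ℕ}
  {ν : ℕ → Vertex → Ω → ℕ} {κ : Vertex → Ω → ℝ} {π : Vertex → Ω → Set ℝ}

lemma measurable_posHits (hκ : ∀ v, Measurable (κ v)) (hπ : ∀ v, pointSigma (π v) ≤ mΩ)
    (y z : Vertex) :
    Measurable fun ω => PosHits (fun v => κ v ω) (fun v => π v ω) y z := by
  have := (measurable_ratHits y z).comp
    ((measurable_pi_iff.2 hκ).prodMk (measurable_ratPoints π hπ))
  simpa only [Function.comp_def, ratHits_ratPoints] using this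

lemma measurableSet_noHits (hκ : ∀ v, Measurable (κ v)) (hπ : ∀ v, pointSigma (π v) ≤ mΩ)
    (y : Vertex) (S : Finset Vertex) : MeasurableSet (noHits κ π y S) :=
  Measurable.setOf <| Measurable.forall fun z => measurable_const.imp
    (measurable_posHits hκ hπ y z).not

namespace IsInput

lemma measure_noHits (h : IsInput P n ν κ π) [IsProbabilityMeasure P] (y : Vertex)
    (S : Finset Vertex) : P (noHits κ π y S) = ENNReal.ofReal (2 / (2 + S.card / n)) := by
  have := h.measure_forall_not_posHits {y} fun _ => S
  simpa [noHits] using this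

lemma blockSigma_le (h : IsInput P n ν κ π) (i : BlockIndex) : blockSigma ν κ π i ≤ mΩ := by
  rcases i with p | y
  · exact (h.measurable_offspring _ _).comap_le
  · refine MeasurableSpace.generateFrom_le ?_
    rintro _ ⟨S, rfl⟩
    exact measurableSet_noHits h.measurable_length (fun v => h.inputSigma_le (.inr (.inr v))) y S

lemma blocksSigma_le (h : IsInput P n ν κ π) (S : Set BlockIndex) : blocksSigma ν κ π S ≤ mΩ :=
  iSup₂_le fun i _ => h.blockSigma_le i

/-- The events `noHits` form a π-system on each edge, and on these the joint probability is the
product computed in `measure_forall_not_posHits`; the offspring numbers are independent of all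
lengths and points. -/
lemma iIndep_blockSigma (h : IsInput P n ν κ π) [IsProbabilityMeasure P] :
    iIndep (blockSigma ν κ π) P := by
  classical
  let C : BlockIndex → Set (Set Ω)
    | .inl p => {s | MeasurableSet[MeasurableSpace.comap (ν p.1 p.2) inferInstance] s}
    | .inr y => Set.range (noHits κ π y)
  refine iIndepSets.iIndep h.blockSigma_le C ?_ ?_ ?_
  · rintro (p | y)
    · exact @MeasurableSpace.isPiSystem_measurableSet _ (MeasurableSpace.comap (ν p.1 p.2) _)
    · exact isPiSystem_noHits κ π y
  · rintro (p | y)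
    · exact (@MeasurableSpace.generateFrom_measurableSet _
        (MeasurableSpace.comap (ν p.1 p.2) _)).symm
    · rfl
  · rw [iIndepSets_iff]
    intro s f hf
    have hl : ∀ p ∈ s.toLeft, MeasurableSet[inputSigma ν κ π (.inl p)] (f (.inl p)) :=
      fun p hp => hf _ (Finset.mem_toLeft.1 hp)
    have hr : ∀ y ∈ s.toRight, ∃ S, noHits κ π y S = f (.inr y) :=
      fun y hy => hf _ (Finset.mem_toRight.1 hy)
    choose! S hS using hr
    have hsplit : ⋂ i ∈ s, f i =
        (⋂ p ∈ s.toLeft, f (.inl p)) ∩ ⋂ y ∈ s.toRight, f (.inr y) := by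
      ext ω
      simp
    have hright : ⋂ y ∈ s.toRight, f (.inr y) =
        {ω | ∀ y ∈ s.toRight, ∀ z ∈ S y, ¬ PosHits (fun v => κ v ω) (fun v => π v ω) y z} := by
      ext ω
      simp only [Set.mem_iInter, Set.mem_ofPred_eq]
      refine forall₂_congr fun y hy => ?_
      rw [← hS y hy]
      rfl
    have hd : Disjoint
        (Set.range fun p : ℕ × Vertex => (.inl p : (ℕ × Vertex) ⊕ Vertex ⊕ Vertex))
        (Set.range fun v : Vertex ⊕ Vertex => .inr v) := by
      rw [Set.disjoint_left]
      rintro _ ⟨v, rfl⟩ ⟨w, hw⟩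
      simp at hw
    have hind := indep_iSup_of_disjoint h.inputSigma_le h.indep hd
    rw [iSup_range, iSup_range, Indep_iff] at hind
    have hml : MeasurableSet[⨆ p, inputSigma ν κ π (.inl p)] (⋂ p ∈ s.toLeft, f (.inl p)) := by
      refine @Finset.measurableSet_biInter _ _ (⨆ p, inputSigma ν κ π (.inl p)) _ _ fun p hp => ?_
      exact le_iSup (fun p => inputSigma ν κ π (.inl p)) p _ (hl p hp)
    have hmr : MeasurableSet[⨆ p, inputSigma ν κ π (.inr p)] (⋂ y ∈ s.toRight, f (.inr y)) := by
      refine @Finset.measurableSet_biInter _ _ (⨆ p, inputSigma ν κ π (.inr p)) _ _ fun y hy => ?_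
      rw [← hS y hy]
      refine @measurableSet_noHits _ (⨆ p, inputSigma ν κ π (.inr p)) κ π (fun v => ?_)
        (fun v => le_iSup (fun p => inputSigma ν κ π (.inr p)) (.inr v)) y (S y)
      exact Measurable.mono (comap_measurable (κ v))
        (le_iSup (fun p => inputSigma ν κ π (.inr p)) (.inl v)) le_rfl
    have hleft : iIndep (fun p => inputSigma ν κ π (.inl p)) P :=
      h.indep.precomp (g := fun p : ℕ × Vertex => (.inl p : (ℕ × Vertex) ⊕ Vertex ⊕ Vertex))
        fun v w h => by simpa using h
    rw [hsplit, hind _ _ hml hmr, hleft.meas_biInter hl, hright, h.measure_forall_not_posHits]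
    conv_rhs => rw [← Finset.toLeft_disjSum_toRight (u := s), Finset.prod_disjSum]
    congr 1
    refine Finset.prod_congr rfl fun y hy => ?_
    rw [← hS y hy, h.measure_noHits]

lemma indep_blocksSigma (h : IsInput P n ν κ π) [IsProbabilityMeasure P] {S S' : Set BlockIndex}
    (hd : Disjoint S S') : Indep (blocksSigma ν κ π S) (blocksSigma ν κ π S') P :=
  indep_iSup_of_disjoint h.blockSigma_le h.iIndep_blockSigma hd

end IsInput
end Input

/-! ### Measurability of the recursion -/

instance : MeasurableSpace (Finset Vertex) := ⊤

instance : DiscreteMeasurableSpace (Finset Vertex) := ⟨fun _ => trivial⟩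

lemma measurable_grow {Ω : Type*} [MeasurableSpace Ω] {k : Ω → ℕ} {a b : Ω → Finset Vertex}
    (hk : Measurable k) (ha : Measurable a) (hb : Measurable b) :
    Measurable fun ω => grow (k ω) (a ω) (b ω) :=
  (measurable_of_countable fun p : ℕ × Finset Vertex × Finset Vertex =>
    grow p.1 p.2.1 p.2.2).comp (hk.prodMk (ha.prodMk hb))

lemma measurable_cutIf {Ω : Type*} [MeasurableSpace Ω] {B : Ω → Finset Vertex}
    {e : Ω → Vertex → Prop} (hB : Measurable B) (he : ∀ z, Measurable fun ω => e ω z) :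
    Measurable fun ω => cutIf (e ω) (B ω) := by
  refine measurable_to_countable' fun t => ?_
  have : (fun ω => cutIf (e ω) (B ω)) ⁻¹' {t} = ⋃ S, B ⁻¹' {S} ∩
      {ω | ((∃ z, z ∈ S ∧ e ω z) ∧ ∅ = t) ∨ (¬ (∃ z, z ∈ S ∧ e ω z) ∧ S = t)} := by
    ext ω
    simp only [Set.mem_preimage, Set.mem_singleton_iff, Set.mem_iUnion, Set.mem_inter_iff,
      exists_eq_left', Set.mem_ofPred_eq]
    by_cases h : ∃ z, z ∈ B ω ∧ e ω z
    · rw [cutIf_eq_empty h]; simp [h]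
    · rw [cutIf_eq_self h]; simp [h]
  rw [this]
  refine MeasurableSet.iUnion fun S => (hB (measurableSet_singleton S)).inter (Measurable.setOf ?_)
  have h1 : Measurable fun ω => ∃ z, z ∈ S ∧ e ω z :=
    Measurable.exists fun z => measurable_const.and (he z)
  exact (h1.and measurable_const).or (h1.not.and measurable_const)

/-- The recursion above `v` uses only offspring numbers and hits attached at or above `v`. This
makes the alive sets above two siblings independent. -/
lemma measurable_alive {Ω : Type*} {ν : ℕ → Vertex → Ω → ℕ} {κ : Vertex → Ω → ℝ}
    {π : Vertex → Ω → Set ℝ} (d : ℕ) (v : Vertex) :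
    Measurable[blocksSigma ν κ π (blocksAbove v)] fun ω =>
      alive (offspring fun i u => ν i u ω) (PosHits (fun v => κ v ω) fun v => π v ω) d v := by
  induction d generalizing v with
  | zero => exact measurable_const
  | succ d ih =>
    refine @measurable_cutIf _ (blocksSigma ν κ π (blocksAbove v)) _ _
      (@measurable_grow _ (blocksSigma ν κ π (blocksAbove v)) _ _ _ ?_ ?_ ?_) fun z => ?_
    · exact (measurable_offspring v).mono (blocksSigma_mono (offspringBlock_subset v)) le_rfl
    · exact (ih _).mono (blocksSigma_mono (blocksAbove_mono (List.prefix_append _ _))) le_rfl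
    · exact (ih _).mono (blocksSigma_mono (blocksAbove_mono (List.prefix_append _ _))) le_rfl
    · exact (measurable_posHits_blockSigma v z).mono
        (blockSigma_le_blocksSigma (List.prefix_refl v)) le_rfl

lemma measurable_or_and {Ω : Type*} [m : MeasurableSpace Ω] {p q r : Ω → Prop} (hp : Measurable p)
    (hq : Measurable q) (hr : Measurable r) : Measurable fun ω => p ω ∨ (q ω ∧ r ω) :=
  hp.or (hq.and hr)

lemma measurable_terminates {Ω : Type*} {ν : ℕ → Vertex → Ω → ℕ} {κ : Vertex → Ω → ℝ}
    {π : Vertex → Ω → Set ℝ} (d : ℕ) (v : Vertex) :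
    Measurable[blocksSigma ν κ π (blocksAbove v)] fun ω =>
      Terminates (fun v => offspring (fun i u => ν i u ω) v ≠ 2) d v := by
  have h0 : ∀ v, Measurable[blocksSigma ν κ π (blocksAbove v)] fun ω =>
      offspring (fun i u => ν i u ω) v ≠ 2 := fun v =>
    (measurable_of_countable fun k : ℕ => k ≠ 2).comp
      ((measurable_offspring v).mono (blocksSigma_mono (offspringBlock_subset v)) le_rfl)
  induction d generalizing v with
  | zero => exact h0 v
  | succ d ih =>
    refine measurable_or_and (m := blocksSigma ν κ π (blocksAbove v)) (h0 v) ?_ ?_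
    · exact (ih _).mono (blocksSigma_mono (blocksAbove_mono (List.prefix_append _ _))) le_rfl
    · exact (ih _).mono (blocksSigma_mono (blocksAbove_mono (List.prefix_append _ _))) le_rfl

/-! ### Recursion for the law of the number of alive nodes -/

open scoped ENNReal

section

variable {Ω : Type*}

/-- Decompose according to the value `S` of `B`: a nonempty result means that no element of `S`
hits, an independent event whose probability depends on `S` only through its cardinality. -/
lemma measure_card_cutIf {m₁ m₂ : MeasurableSpace Ω} [mΩ : MeasurableSpace Ω] {P : Measure Ω}
    (h₁ : m₁ ≤ mΩ) (h₂ : m₂ ≤ mΩ)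
    (hind : Indep m₁ m₂ P) {B : Ω → Finset Vertex} (hB : Measurable[m₁] B)
    {e : Ω → Vertex → Prop} (he : ∀ S : Finset Vertex, MeasurableSet[m₂] {ω | ∀ z ∈ S, ¬ e ω z})
    {φ : ℕ → ℝ≥0∞} (hφ : ∀ S : Finset Vertex, P {ω | ∀ z ∈ S, ¬ e ω z} = φ S.card) (k : ℕ) :
    P {ω | (cutIf (e ω) (B ω)).card = k + 1} = φ (k + 1) * P {ω | (B ω).card = k + 1} := by
  have hB' : Measurable B := hB.mono h₁ le_rfl
  have h1 : {ω | (cutIf (e ω) (B ω)).card = k + 1} =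
      ⋃ S : {S : Finset Vertex // S.card = k + 1},
        B ⁻¹' {S.1} ∩ {ω | ∀ z ∈ S.1, ¬ e ω z} := by
    ext ω
    simp only [Set.mem_ofPred_eq, Set.mem_iUnion, Set.mem_inter_iff, Set.mem_preimage,
      Set.mem_singleton_iff, Subtype.exists]
    constructor
    · intro h
      by_cases hc : ∃ z ∈ B ω, e ω z
      · simp [cutIf_eq_empty hc] at h
      · rw [cutIf_eq_self hc] at h
        push Not at hc
        exact ⟨_, h, rfl, hc⟩
    · rintro ⟨S, hS, rfl, hc⟩
      rwa [cutIf_eq_self (by push Not; exact hc)]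
  have h2 : {ω | (B ω).card = k + 1} =
      ⋃ S : {S : Finset Vertex // S.card = k + 1}, B ⁻¹' {S.1} := by
    ext ω
    simp
  have hdisj : Pairwise (Function.onFun Disjoint
      fun S : {S : Finset Vertex // S.card = k + 1} => B ⁻¹' {S.1}) := by
    intro S S' hne
    rw [Function.onFun, Set.disjoint_left]
    intro ω hω hω'
    exact hne (Subtype.ext (hω.symm.trans hω'))
  rw [h1, h2, measure_iUnion hdisj fun S => hB' (measurableSet_singleton _), measure_iUnion,
    ← ENNReal.tsum_mul_left]
  · refine tsum_congr fun S => ?_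
    rw [(Indep_iff _ _ _).1 hind _ _ (hB (measurableSet_singleton S.1)) (he S.1), hφ, S.2,
      mul_comm]
  · intro S S' hne
    exact (hdisj hne).mono Set.inter_subset_left Set.inter_subset_left
  · exact fun S => (hB' (measurableSet_singleton _)).inter (h₂ _ (he S.1))

lemma measure_card_grow {m₁ m₂ m₃ : MeasurableSpace Ω}
    [mΩ : MeasurableSpace Ω] {P : Measure Ω}
    (h₁ : m₁ ≤ mΩ) (h₂ : m₂ ≤ mΩ)
    (h₃ : m₃ ≤ mΩ) (hind : Indep m₁ m₂ P) (hind' : Indep (m₁ ⊔ m₂) m₃ P)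
    {a b : Ω → Finset Vertex} {N : Ω → ℕ} (ha : Measurable[m₁] a) (hb : Measurable[m₂] b)
    (hN : Measurable[m₃] N) (k : ℕ) :
    P {ω | (grow (N ω) (a ω) (b ω)).card = k + 1} =
      P {ω | N ω = 2} * ∑ p ∈ Finset.HasAntidiagonal.antidiagonal k,
        P {ω | (a ω).card = p.1} * P {ω | (b ω).card = p.2} := by
  have hA : ∀ i, MeasurableSet[m₁] {ω | (a ω).card = i} := fun i =>
    ha (MeasurableSet.of_discrete (s := {s : Finset Vertex | s.card = i}))
  have hB : ∀ i, MeasurableSet[m₂] {ω | (b ω).card = i} := fun i =>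
    hb (MeasurableSet.of_discrete (s := {s : Finset Vertex | s.card = i}))
  have hC : MeasurableSet[m₃] {ω | N ω = 2} := hN (measurableSet_singleton 2)
  have h : {ω | (grow (N ω) (a ω) (b ω)).card = k + 1} =
      ⋃ p ∈ Finset.HasAntidiagonal.antidiagonal k,
        ({ω | (a ω).card = p.1} ∩ {ω | (b ω).card = p.2}) ∩ {ω | N ω = 2} := by
    ext ω
    simp only [Set.mem_ofPred_eq, Set.mem_iUnion, Set.mem_inter_iff,
      Finset.HasAntidiagonal.mem_antidiagonal, grow]
    by_cases h2 : N ω = 2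
    · simp only [h2, if_true, card_graft, and_true]
      constructor
      · exact fun h => ⟨((a ω).card, (b ω).card), by omega, rfl, rfl⟩
      · rintro ⟨⟨i, j⟩, h1, h2, h3⟩
        simp only at h1 h2 h3
        omega
    · simp [h2]
  rw [h, measure_biUnion_finset, Finset.mul_sum]
  · refine Finset.sum_congr rfl fun p _ => ?_
    rw [(Indep_iff _ _ _).1 hind' _ _
      (((le_sup_left : m₁ ≤ m₁ ⊔ m₂) _ (hA p.1)).inter ((le_sup_right : m₂ ≤ m₁ ⊔ m₂) _ (hB p.2)))
      hC, (Indep_iff _ _ _).1 hind _ _ (hA p.1) (hB p.2), mul_comm]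
  · intro p _ q _ hne
    rw [Function.onFun, Set.disjoint_left]
    rintro ω ⟨⟨h1, h2⟩, -⟩ ⟨⟨h3, h4⟩, -⟩
    exact hne (Prod.ext (h1.symm.trans h3) (h2.symm.trans h4))
  · exact fun p _ => ((h₁ _ (hA p.1)).inter (h₂ _ (hB p.2))).inter (h₃ _ hC)

/-- The recursions determine the probabilities of positive values only; the atom at 0 is recovered
from the total mass. -/
lemma measure_eq_zero_congr [mΩ : MeasurableSpace Ω] {P : Measure Ω} [IsProbabilityMeasure P]
    {X Y : Ω → ℕ} (hX : Measurable X) (hY : Measurable Y) (h : ∀ k, P {ω | X ω = k + 1} = P {ω | Y ω = k + 1}) :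
    P {ω | X ω = 0} = P {ω | Y ω = 0} := by
  have key : ∀ Z : Ω → ℕ, Measurable Z → P {ω | Z ω = 0} = 1 - ∑' k, P {ω | Z ω = k + 1} := by
    intro Z hZ
    rw [← measure_iUnion, ← prob_compl_eq_one_sub]
    · congr 1
      ext ω
      simp only [Set.mem_ofPred_eq, Set.mem_compl_iff, Set.mem_iUnion, not_exists]
      refine ⟨fun h k => by omega, fun h => ?_⟩
      by_contra h0
      exact h (Z ω - 1) (by omega)
    · exact MeasurableSet.iUnion fun k => hZ (measurableSet_singleton (k + 1))
    · intro i j hij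
      rw [Function.onFun, Set.disjoint_left]
      intro ω (h1 : Z ω = i + 1) (h2 : Z ω = j + 1)
      omega
    · exact fun k => hZ (measurableSet_singleton (k + 1))
  rw [key X hX, key Y hY]
  simp_rw [h]

end

section Input

variable {Ω : Type*} [mΩ : MeasurableSpace Ω] {P : Measure Ω} {n : ℕ}
  {ν : ℕ → Vertex → Ω → ℕ} {κ : Vertex → Ω → ℝ} {π : Vertex → Ω → Set ℝ}

/-- The number of alive nodes above `v` in the pruning of the tree truncated `d` generations
above `v`. -/
noncomputable def aliveCard (ν : ℕ → Vertex → Ω → ℕ) (κ : Vertex → Ω → ℝ) (π : Vertex → Ω → Set ℝ)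
    (d : ℕ) (v : Vertex) (ω : Ω) : ℕ :=
  (alive (offspring fun i u => ν i u ω) (PosHits (fun v => κ v ω) fun v => π v ω) d v).card

namespace IsInput

lemma measurable_aliveCard (h : IsInput P n ν κ π) (d : ℕ) (v : Vertex) :
    Measurable (aliveCard ν κ π d v) :=
  (measurable_of_countable Finset.card).comp
    ((measurable_alive d v).mono (h.blocksSigma_le _) le_rfl)

lemma measure_offspring_planted (h : IsInput P n ν κ π) (i : ℕ) (w : Vertex) :
    P {ω | offspring (fun i u => ν i u ω) (spine i ++ 0 :: w) = 2} = 1 / 2 := by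
  simp only [offspring_planted]
  exact h.offspring_two i w

variable [IsProbabilityMeasure P]

lemma indep_children (h : IsInput P n ν κ π) (v : Vertex) :
    Indep (blocksSigma ν κ π (blocksAbove (v ++ [0])))
      (blocksSigma ν κ π (blocksAbove (v ++ [1]))) P :=
  h.indep_blocksSigma (disjoint_blocksAbove v)

lemma indep_offspring (h : IsInput P n ν κ π) (v : Vertex) :
    Indep (blocksSigma ν κ π (blocksAbove (v ++ [0])) ⊔ blocksSigma ν κ π (blocksAbove (v ++ [1])))
      (blocksSigma ν κ π (offspringBlock v)) P := by
  have := h.indep_blocksSigma (disjoint_blocksAbove_offspringBlock v)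
  rwa [blocksSigma, iSup_union] at this

/-- The three factors come from the edge `v` escaping the hits of `k + 1` senders, from `v`
branching, and from the convolution of the independent counts above its children; `v` itself
accounts for the extra node. -/
lemma measure_aliveCard_succ (h : IsInput P n ν κ π) (d : ℕ) (v : Vertex) (k : ℕ) :
    P {ω | aliveCard ν κ π (d + 1) v ω = k + 1} =
      ENNReal.ofReal (2 / (2 + (k + 1 : ℕ) / n)) *
        (P {ω | offspring (fun i u => ν i u ω) v = 2} * ∑ p ∈ Finset.HasAntidiagonal.antidiagonal k,
          P {ω | aliveCard ν κ π d (v ++ [0]) ω = p.1} *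
          P {ω | aliveCard ν κ π d (v ++ [1]) ω = p.2}) := by
  set S : Set BlockIndex := (blocksAbove (v ++ [0]) ∪ blocksAbove (v ++ [1])) ∪ offspringBlock v
  have h0 : blocksSigma ν κ π (blocksAbove (v ++ [0])) ≤ blocksSigma ν κ π S :=
    blocksSigma_mono fun i hi => Or.inl (Or.inl hi)
  have h1 : blocksSigma ν κ π (blocksAbove (v ++ [1])) ≤ blocksSigma ν κ π S :=
    blocksSigma_mono fun i hi => Or.inl (Or.inr hi)
  have h2 : blocksSigma ν κ π (offspringBlock v) ≤ blocksSigma ν κ π S :=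
    blocksSigma_mono fun i hi => Or.inr hi
  have hg := @measurable_grow _ (blocksSigma ν κ π S) _ _ _
    ((ForestFire.measurable_offspring (ν := ν) (κ := κ) (π := π) v).mono h2 le_rfl)
    ((measurable_alive (ν := ν) (κ := κ) (π := π) d (v ++ [0])).mono h0 le_rfl)
    ((measurable_alive (ν := ν) (κ := κ) (π := π) d (v ++ [1])).mono h1 le_rfl)
  have hcut := measure_card_cutIf (P := P) (h.blocksSigma_le S) (h.blocksSigma_le {(.inr v)})
    (h.indep_blocksSigma (disjoint_edgeBlock v)) hg
    (e := fun ω => PosHits (fun v => κ v ω) (fun v => π v ω) v)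
    (φ := fun k => ENNReal.ofReal (2 / (2 + k / n)))
    (fun T => blockSigma_le_blocksSigma (ν := ν) (κ := κ) (π := π) (Set.mem_singleton _) _
      (MeasurableSpace.measurableSet_generateFrom (Set.mem_range_self T)))
    (fun T => h.measure_noHits v T) k
  refine hcut.trans ?_
  rw [measure_card_grow (h.blocksSigma_le _) (h.blocksSigma_le _) (h.blocksSigma_le _)
    (h.indep_children v) (h.indep_offspring v) (measurable_alive d (v ++ [0]))
    (measurable_alive d (v ++ [1])) (ForestFire.measurable_offspring v)]
  rfl

lemma measure_offspring_spine (i : ℕ) :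
    P {ω | offspring (fun i u => ν i u ω) (spine i) = 2} = 1 := by
  simp [offspring_spine]

/-- The planted trees are identically distributed, and so are their subtrees. -/
lemma measure_aliveCard_planted (h : IsInput P n ν κ π) (d : ℕ) (i : ℕ) (w : Vertex) (k : ℕ) :
    P {ω | aliveCard ν κ π d (spine i ++ 0 :: w) ω = k} = P {ω | aliveCard ν κ π d [0] ω = k} := by
  induction d generalizing i w k with
  | zero => rfl
  | succ d ih =>
    have hk : ∀ k, P {ω | aliveCard ν κ π (d + 1) (spine i ++ 0 :: w) ω = k + 1} =
        P {ω | aliveCard ν κ π (d + 1) [0] ω = k + 1} := by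
      intro k
      have h0 : P {ω | offspring (fun i u => ν i u ω) [0] = 2} = 1 / 2 :=
        h.measure_offspring_planted 0 []
      have e0 : ∀ j k, P {ω | aliveCard ν κ π d [0, j] ω = k} =
          P {ω | aliveCard ν κ π d [0] ω = k} := fun j k => ih 0 [j] k
      rw [h.measure_aliveCard_succ, h.measure_aliveCard_succ, h.measure_offspring_planted, h0]
      simp only [List.append_assoc, List.cons_append, List.nil_append, ih, e0]
    rcases k with _ | k
    · exact measure_eq_zero_congr (h.measurable_aliveCard _ _) (h.measurable_aliveCard _ _) hk
    · exact hk k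

/-- The tree seen from any backbone vertex has the same law. -/
lemma measure_aliveCard_spine (h : IsInput P n ν κ π) (d : ℕ) (i : ℕ) (k : ℕ) :
    P {ω | aliveCard ν κ π d (spine i) ω = k} = P {ω | aliveCard ν κ π d [] ω = k} := by
  induction d generalizing i k with
  | zero => rfl
  | succ d ih =>
    have hk : ∀ k, P {ω | aliveCard ν κ π (d + 1) (spine i) ω = k + 1} =
        P {ω | aliveCard ν κ π (d + 1) [] ω = k + 1} := by
      intro k
      have h0 : P {ω | offspring (fun i u => ν i u ω) [] = 2} = 1 := measure_offspring_spine 0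
      have e0 : ∀ k, P {ω | aliveCard ν κ π d [1] ω = k} =
          P {ω | aliveCard ν κ π d [] ω = k} := fun k => ih 1 k
      rw [h.measure_aliveCard_succ, h.measure_aliveCard_succ, measure_offspring_spine, h0]
      simp only [spine_concat, ih, e0, h.measure_aliveCard_planted, List.nil_append]
    rcases k with _ | k
    · exact measure_eq_zero_congr (h.measurable_aliveCard _ _) (h.measurable_aliveCard _ _) hk
    · exact hk k

lemma measure_aliveCard_planted_succ (h : IsInput P n ν κ π) (d : ℕ) (k : ℕ) :
    P {ω | aliveCard ν κ π (d + 1) [0] ω = k + 1} =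
      ENNReal.ofReal (2 / (2 + (k + 1 : ℕ) / n)) *
        (1 / 2 * ∑ p ∈ Finset.HasAntidiagonal.antidiagonal k,
          P {ω | aliveCard ν κ π d [0] ω = p.1} * P {ω | aliveCard ν κ π d [0] ω = p.2}) := by
  have h0 : P {ω | offspring (fun i u => ν i u ω) [0] = 2} = 1 / 2 :=
    h.measure_offspring_planted 0 []
  have e0 : ∀ j k, P {ω | aliveCard ν κ π d [0, j] ω = k} =
      P {ω | aliveCard ν κ π d [0] ω = k} := fun j k => h.measure_aliveCard_planted d 0 [j] k
  rw [h.measure_aliveCard_succ, h0]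
  simp only [List.cons_append, List.nil_append, e0]

lemma measure_aliveCard_spine_succ (h : IsInput P n ν κ π) (d : ℕ) (k : ℕ) :
    P {ω | aliveCard ν κ π (d + 1) [] ω = k + 1} =
      ENNReal.ofReal (2 / (2 + (k + 1 : ℕ) / n)) * ∑ p ∈ Finset.HasAntidiagonal.antidiagonal k,
          P {ω | aliveCard ν κ π d [0] ω = p.1} * P {ω | aliveCard ν κ π d [] ω = p.2} := by
  have h0 : P {ω | offspring (fun i u => ν i u ω) [] = 2} = 1 := measure_offspring_spine 0
  have e0 : ∀ k, P {ω | aliveCard ν κ π d [1] ω = k} =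
      P {ω | aliveCard ν κ π d [] ω = k} := fun k => h.measure_aliveCard_spine d 1 k
  rw [h.measure_aliveCard_succ, h0, one_mul]
  simp only [e0, List.nil_append]

end IsInput
end Input
/-! ### Almost sure regularity of the input -/

open Filter Topology
open scoped ENNReal

/-- The probability that a critical binary Galton-Watson tree has height at most `d`. -/
noncomputable def extinctionSeq : ℕ → ℝ
  | 0 => 1 / 2
  | d + 1 => 1 / 2 + extinctionSeq d * extinctionSeq d / 2

lemma extinctionSeq_mem (d : ℕ) : 0 ≤ extinctionSeq d ∧ extinctionSeq d ≤ 1 := by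
  induction d with
  | zero => norm_num [extinctionSeq]
  | succ d ih =>
    rw [extinctionSeq]
    constructor <;> nlinarith [ih.1, ih.2]

lemma tendsto_extinctionSeq : Tendsto extinctionSeq atTop (𝓝 1) := by
  have hmono : Monotone extinctionSeq := by
    refine monotone_nat_of_le_succ fun d => ?_
    rw [extinctionSeq]
    nlinarith [sq_nonneg (extinctionSeq d - 1)]
  have hbdd : BddAbove (Set.range extinctionSeq) := by
    refine ⟨1, ?_⟩
    rintro _ ⟨d, rfl⟩
    exact (extinctionSeq_mem d).2
  have hlim := tendsto_atTop_ciSup hmono hbdd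
  set l := ⨆ d, extinctionSeq d
  have h1 : Tendsto (fun d => extinctionSeq (d + 1)) atTop (𝓝 (1 / 2 + l * l / 2)) := by
    simp only [extinctionSeq]
    exact ((hlim.mul hlim).div_const 2).const_add _
  have h2 := tendsto_nhds_unique h1 (hlim.comp (tendsto_add_atTop_nat 1))
  -- Criticality: 1 is a double root, hence the only root, of l = (1 + l²)/2.
  have h3 : (l - 1) ^ 2 = 0 := by linarith
  have h4 : l = 1 := by
    have := pow_eq_zero_iff (two_ne_zero) |>.1 h3
    linarith
  rwa [h4] at hlim

section Input

variable {Ω : Type*} [mΩ : MeasurableSpace Ω] {P : Measure Ω} [IsProbabilityMeasure P] {n : ℕ}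
  {ν : ℕ → Vertex → Ω → ℕ} {κ : Vertex → Ω → ℝ} {π : Vertex → Ω → Set ℝ}

namespace IsInput

lemma ae_offspring (h : IsInput P n ν κ π) : ∀ᵐ ω ∂P, ∀ i v, ν i v ω = 0 ∨ ν i v ω = 2 := by
  rw [ae_all_iff]
  intro i
  rw [ae_all_iff]
  intro v
  have h0 : MeasurableSet {ω | ν i v ω = 0} :=
    h.measurable_offspring i v (measurableSet_singleton 0)
  have h2 : MeasurableSet {ω | ν i v ω = 2} :=
    h.measurable_offspring i v (measurableSet_singleton 2)
  have hd : Disjoint {ω | ν i v ω = 0} {ω | ν i v ω = 2} := by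
    rw [Set.disjoint_left]
    intro ω (h : ν i v ω = 0) (h' : ν i v ω = 2)
    omega
  have := measure_union (μ := P) hd h2
  rw [h.offspring_zero, h.offspring_two, ENNReal.add_halves,
    ← mem_ae_iff_prob_eq_one (h0.union h2)] at this
  exact this

/-- A count with a Poisson law is almost surely a natural number, so the infinite value of `encard`
has probability 0. -/
lemma ae_finite_points (h : IsInput P n ν κ π) :
    ∀ᵐ ω ∂P, ∀ v (r : ℕ), (π v ω ∩ Set.Ioo 0 (r : ℝ)).Finite := by
  rw [ae_all_iff]
  intro v
  rw [ae_all_iff]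
  intro r
  have hB : Set.Ioo 0 (r : ℝ) ⊆ Set.Ioi 0 := fun x hx => hx.1
  have hm : ∀ k : ℕ, MeasurableSet {ω | (π v ω ∩ Set.Ioo 0 (r : ℝ)).encard = k} := fun k =>
    (h.poisson v).measurable_count _ measurableSet_Ioo hB
      (MeasurableSet.of_discrete (s := {(k : ℕ∞)}))
  have h1 : P (⋃ k : ℕ, {ω | (π v ω ∩ Set.Ioo 0 (r : ℝ)).encard = k}) = 1 := by
    rw [measure_iUnion _ hm]
    · have := (h.poisson v).count_law _ measurableSet_Ioo hB
        (by simp : volume (Set.Ioo 0 (r : ℝ)) ≠ ⊤)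
      simp_rw [this]
      set μ := poissonMeasure (1 / (n : ℝ≥0) * (volume (Set.Ioo 0 (r : ℝ))).toNNReal)
      rw [← measure_iUnion (fun i j hij => by simpa [Function.onFun] using hij)
        fun k => measurableSet_singleton k, Set.iUnion_of_singleton, measure_univ]
    · intro i j hij
      rw [Function.onFun, Set.disjoint_left]
      intro ω h1 h2
      have h3 : (i : ℕ∞) = j := h1.symm.trans h2
      exact hij (by exact_mod_cast h3)
  rw [← mem_ae_iff_prob_eq_one (MeasurableSet.iUnion hm)] at h1
  filter_upwards [h1] with ω hω
  obtain ⟨k, hk⟩ := Set.mem_iUnion.1 hω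
  exact Set.finite_of_encard_eq_coe hk

lemma measure_terminates (h : IsInput P n ν κ π) (d i : ℕ) (w : Vertex) :
    P {ω | Terminates (fun v => offspring (fun i u => ν i u ω) v ≠ 2) d (spine i ++ 0 :: w)} =
      ENNReal.ofReal (extinctionSeq d) := by
  have hN : ∀ w, MeasurableSet {ω | offspring (fun i u => ν i u ω) (spine i ++ 0 :: w) = 2} := by
    intro w
    simp only [offspring_planted]
    exact h.measurable_offspring i w (measurableSet_singleton 2)
  have hhalf : ENNReal.ofReal (1 / 2) = 1 / 2 := by
    rw [ENNReal.ofReal_div_of_pos two_pos]; simp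
  have hN' : ∀ w, P {ω | offspring (fun i u => ν i u ω) (spine i ++ 0 :: w) ≠ 2} =
      ENNReal.ofReal (1 / 2) := by
    intro w
    have := prob_compl_eq_one_sub (μ := P) (hN w)
    rw [h.measure_offspring_planted, one_div, ENNReal.one_sub_inv_two] at this
    rw [hhalf, one_div]
    exact this
  induction d generalizing w with
  | zero => exact hN' w
  | succ d ih =>
    set v := spine i ++ 0 :: w with hv
    set N : Ω → ℕ := fun ω => offspring (fun i u => ν i u ω) v with hNdef
    set T : ℕ → Set Ω := fun j =>
      {ω | Terminates (fun v => offspring (fun i u => ν i u ω) v ≠ 2) d (v ++ [j])} with hTdef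
    have hT : ∀ j, MeasurableSet[blocksSigma ν κ π (blocksAbove (v ++ [j]))] (T j) := fun j =>
      (@measurableSet_setOfPred _ (blocksSigma ν κ π (blocksAbove (v ++ [j]))) _).2
        (measurable_terminates d (v ++ [j]))
    have hTm : ∀ j, MeasurableSet (T j) := fun j => h.blocksSigma_le _ _ (hT j)
    have hNm : MeasurableSet[blocksSigma ν κ π (offspringBlock v)] {ω | N ω = 2} :=
      ForestFire.measurable_offspring v (measurableSet_singleton 2)
    have hTv : ∀ j, P (T j) = ENNReal.ofReal (extinctionSeq d) := by
      intro j
      simp only [hTdef, hv, List.append_assoc, List.cons_append]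
      exact ih _
    have hset : {ω | Terminates (fun v => offspring (fun i u => ν i u ω) v ≠ 2) (d + 1) v} =
        {ω | N ω ≠ 2} ∪ ((T 0 ∩ T 1) ∩ {ω | N ω = 2}) := by
      ext ω
      simp only [Terminates, Set.mem_ofPred_eq, Set.mem_union, Set.mem_inter_iff, hTdef, hNdef]
      tauto
    have hdisj : Disjoint {ω | N ω ≠ 2} ((T 0 ∩ T 1) ∩ {ω | N ω = 2}) := by
      rw [Set.disjoint_left]
      rintro ω h1 ⟨-, h2⟩
      exact h1 h2
    rw [hset, measure_union hdisj (((hTm 0).inter (hTm 1)).inter (hN w)), hN',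
      (Indep_iff _ _ _).1 (h.indep_offspring v) _ _
        (((le_sup_left : _ ≤ blocksSigma ν κ π (blocksAbove (v ++ [0])) ⊔ _) _ (hT 0)).inter
        ((le_sup_right : _ ≤ _ ⊔ blocksSigma ν κ π (blocksAbove (v ++ [1]))) _ (hT 1))) hNm,
      (Indep_iff _ _ _).1 (h.indep_children v) _ _ (hT 0) (hT 1), hTv, hTv,
      h.measure_offspring_planted, ← hhalf, ← ENNReal.ofReal_mul (extinctionSeq_mem d).1,
      ← ENNReal.ofReal_mul (mul_self_nonneg _), ← ENNReal.ofReal_add (by norm_num)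
        (mul_nonneg (mul_self_nonneg _) (by norm_num)), extinctionSeq]
    congr 1
    ring

lemma ae_extinct (h : IsInput P n ν κ π) : ∀ᵐ ω ∂P, ∀ i, ∃ d,
    Terminates (fun v => offspring (fun i u => ν i u ω) v ≠ 2) d (spine i ++ [0]) := by
  rw [ae_all_iff]
  intro i
  set E : ℕ → Set Ω := fun d =>
    {ω | Terminates (fun v => offspring (fun i u => ν i u ω) v ≠ 2) d (spine i ++ [0])} with hE
  have hm : ∀ d, MeasurableSet (E d) := fun d => Measurable.setOf
    ((measurable_terminates (ν := ν) (κ := κ) (π := π) d _).mono (h.blocksSigma_le _) le_rfl)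
  have h1 : ENNReal.ofReal 1 ≤ P (⋃ d, E d) := by
    refine le_of_tendsto (ENNReal.tendsto_ofReal tendsto_extinctionSeq)
      (Eventually.of_forall fun d => ?_)
    rw [← h.measure_terminates d i []]
    exact measure_mono (Set.subset_iUnion E d)
  rw [ENNReal.ofReal_one] at h1
  have h2 := (mem_ae_iff_prob_eq_one (MeasurableSet.iUnion hm)).2
    (le_antisymm prob_le_one h1)
  filter_upwards [h2] with ω hω
  obtain ⟨d, hd⟩ := Set.mem_iUnion.1 (show ω ∈ ⋃ d, E d from hω)
  exact ⟨d, hd⟩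

/-- The own marks on distinct backbone edges are independent events of equal positive probability,
so m consecutive failures have probability `φ ^ m`, which tends to 0. -/
lemma ae_own_mark (h : IsInput P n ν κ π) (hn : 1 ≤ n) : ∀ᵐ ω ∂P, ∀ i, ∃ j ≥ i,
    PosHits (fun v => κ v ω) (fun v => π v ω) (spine j) [] := by
  rw [ae_all_iff]
  intro i
  set φ : ℝ≥0∞ := ENNReal.ofReal (2 / (2 + (1 : ℕ) / n)) with hφ
  have hφ1 : φ < 1 := by
    rw [hφ, ← ENNReal.ofReal_one, ENNReal.ofReal_lt_ofReal_iff one_pos, div_lt_one (by positivity)]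
    have : (0 : ℝ) < (1 : ℕ) / n := by positivity
    linarith
  have hinj : Function.Injective fun j => spine (i + j) := by
    intro a b hab
    have := congrArg List.length hab
    simp only [length_spine] at this
    omega
  have hle : ∀ m : ℕ, P {ω | ¬ ∃ j ≥ i, PosHits (fun v => κ v ω) (fun v => π v ω) (spine j) []} ≤
      φ ^ m := by
    intro m
    have := h.measure_forall_not_posHits ((Finset.range m).image fun j => spine (i + j))
      fun _ => {[]}
    rw [Finset.prod_const, Finset.card_image_of_injective _ hinj, Finset.card_range,
      Finset.card_singleton, ← hφ] at this
    rw [← this]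
    refine measure_mono fun ω hω => ?_
    simp only [Set.mem_ofPred_eq, not_exists, not_and] at hω
    intro y hy z hz
    obtain ⟨j, -, rfl⟩ := Finset.mem_image.1 hy
    rw [Finset.mem_singleton.1 hz]
    exact hω _ (by omega)
  have := ge_of_tendsto' (ENNReal.tendsto_pow_atTop_nhds_zero_of_lt_one hφ1) hle
  exact le_antisymm this zero_le

lemma ae_isRegular (h : IsInput P n ν κ π) (hn : 1 ≤ n) :
    ∀ᵐ ω ∂P, IsRegular (fun i v => ν i v ω) (fun v => κ v ω) (fun v => π v ω) := by
  filter_upwards [h.ae_offspring, h.ae_length_pos, h.ae_finite_points, h.ae_extinct,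
    h.ae_own_mark hn] with ω h1 h2 h3 h4 h5
  exact ⟨h1, h2, h3, h4, by rwa [posHits_eq_hits h2] at h5⟩

end IsInput
end Input
/-! ### The equilibrium equation -/

open Finset.HasAntidiagonal in
/-- `p` is a probability on `ℕ` with `r k p_{k+1} = ∑_{i+j=k} p_i p_j`. -/
structure IsQuadraticLaw (r p : ℕ → ℝ) : Prop where
  nonneg : ∀ k, 0 ≤ p k
  hasSum : HasSum p 1
  eqn : ∀ k, r k * p (k + 1) = ∑ x ∈ antidiagonal k, p x.1 * p x.2

open Finset.HasAntidiagonal in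
/-- `s` is a probability on `ℕ` with `r k s_{k+1} = 2 ∑_{i+j=k} p_i s_j`. -/
structure IsLinearLaw (r p s : ℕ → ℝ) : Prop where
  nonneg : ∀ k, 0 ≤ s k
  hasSum : HasSum s 1
  eqn : ∀ k, r k * s (k + 1) = 2 * ∑ x ∈ antidiagonal k, p x.1 * s x.2

lemma eq_of_le_of_hasSum {f g : ℕ → ℝ} {a : ℝ} (h : ∀ k, f k ≤ g k) (hf : HasSum f a)
    (hg : HasSum g a) : f = g := by
  have h0 : HasSum (fun k => g k - f k) 0 := by simpa using hg.sub hf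
  have := (hasSum_zero_iff_of_nonneg fun k => sub_nonneg.2 (h k)).1 h0
  funext k
  have := congrFun this k
  simp only [Pi.zero_apply] at this
  linarith

/-! ### Uniqueness of the laws by comparison. -/

section

variable {r p p' s s' : ℕ → ℝ}

open Finset.HasAntidiagonal

lemma fst_le_of_mem_antidiagonal {k : ℕ} {x : ℕ × ℕ} (hx : x ∈ antidiagonal k) : x.1 ≤ k := by
  rw [mem_antidiagonal] at hx; omega

lemma snd_le_of_mem_antidiagonal {k : ℕ} {x : ℕ × ℕ} (hx : x ∈ antidiagonal k) : x.2 ≤ k := by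
  rw [mem_antidiagonal] at hx; omega

/-- The recursion has nonnegative coefficients, so an inequality at 0 propagates to all indices;
equal total masses then force equality. -/
lemma IsQuadraticLaw.eq_of_le (hr : ∀ k, 0 < r k) (hp : IsQuadraticLaw r p)
    (hp' : IsQuadraticLaw r p') (h : p 0 ≤ p' 0) : p = p' := by
  refine eq_of_le_of_hasSum (fun k => ?_) hp.hasSum hp'.hasSum
  induction k using Nat.strong_induction_on with
  | _ k ih =>
    rcases k with _ | k
    · exact h
    · refine le_of_mul_le_mul_left ?_ (hr k)
      rw [hp.eqn, hp'.eqn]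
      refine Finset.sum_le_sum fun x hx => ?_
      have h1 := fst_le_of_mem_antidiagonal hx
      have h2 := snd_le_of_mem_antidiagonal hx
      exact mul_le_mul (ih _ (by omega)) (ih _ (by omega)) (hp.nonneg _) (hp'.nonneg _)

lemma IsQuadraticLaw.unique (hr : ∀ k, 0 < r k) (hp : IsQuadraticLaw r p)
    (hp' : IsQuadraticLaw r p') : p = p' := by
  rcases le_total (p 0) (p' 0) with h | h
  · exact hp.eq_of_le hr hp' h
  · exact (hp'.eq_of_le hr hp h).symm

lemma IsLinearLaw.eq_of_le (hr : ∀ k, 0 < r k) (hp : ∀ k, 0 ≤ p k) (hs : IsLinearLaw r p s)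
    (hs' : IsLinearLaw r p s') (h : s 0 ≤ s' 0) : s = s' := by
  refine eq_of_le_of_hasSum (fun k => ?_) hs.hasSum hs'.hasSum
  induction k using Nat.strong_induction_on with
  | _ k ih =>
    rcases k with _ | k
    · exact h
    · refine le_of_mul_le_mul_left ?_ (hr k)
      rw [hs.eqn, hs'.eqn]
      refine mul_le_mul_of_nonneg_left (Finset.sum_le_sum fun x hx => ?_) zero_le_two
      have h2 := snd_le_of_mem_antidiagonal hx
      exact mul_le_mul_of_nonneg_left (ih _ (by omega)) (hp _)

lemma IsLinearLaw.unique (hr : ∀ k, 0 < r k) (hp : ∀ k, 0 ≤ p k) (hs : IsLinearLaw r p s)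
    (hs' : IsLinearLaw r p s') : s = s' := by
  rcases le_total (s 0) (s' 0) with h | h
  · exact hs.eq_of_le hr hp hs' h
  · exact (hs'.eq_of_le hr hp hs h).symm

/-- Exchange the two indices and average: their weights add up to i + 1 + j + 1 = k + 2. -/
lemma sum_antidiagonal_mul_succ (p : ℕ → ℝ) (k : ℕ) :
    2 * ∑ x ∈ antidiagonal k, p x.1 * ((x.2 + 1) * p x.2) =
      (k + 2) * ∑ x ∈ antidiagonal k, p x.1 * p x.2 := by
  have hswap : ∑ x ∈ antidiagonal k, p x.1 * ((x.2 + 1) * p x.2) =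
      ∑ x ∈ antidiagonal k, p x.2 * ((x.1 + 1) * p x.1) :=
    (Finset.Nat.sum_antidiagonal_swap (f := fun x : ℕ × ℕ => p x.1 * ((x.2 + 1) * p x.2))).symm
  rw [two_mul]
  nth_rewrite 2 [hswap]
  rw [← Finset.sum_add_distrib, Finset.mul_sum]
  refine Finset.sum_congr rfl fun x hx => ?_
  have : (x.1 : ℝ) + x.2 = k := by exact_mod_cast mem_antidiagonal.1 hx
  rw [← this]
  ring

end

/-- The total rate at which clusters of size `k + 2` disappear. -/
noncomputable def lossRate (n k : ℕ) : ℝ := 2 + ((k : ℝ) + 1) / n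

lemma lossRate_pos (n k : ℕ) : 0 < lossRate n k := by unfold lossRate; positivity

/-! ### Quadratic laws and equilibria. -/

section

variable {n : ℕ} {p : ℕ → ℝ}

lemma IsQuadraticLaw.summable (hn : 1 ≤ n) (hp : IsQuadraticLaw (lossRate n) p) :
    Summable fun k : ℕ => ((k : ℝ) + 1) * p k := by
  have h1 : Summable fun k => lossRate n k * p (k + 1) := by
    simp_rw [hp.eqn]
    exact summable_sum_mul_antidiagonal_of_summable_mul
      (hp.hasSum.summable.mul_of_nonneg hp.hasSum.summable hp.nonneg hp.nonneg)
  rw [← summable_nat_add_iff 1]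
  have hn' : (1 : ℝ) ≤ n := by exact_mod_cast hn
  -- Fragmentation gives the first moment: n times the loss rate is 2n + k + 1, at least k + 2, and
  -- the rate times `p (k + 1)` is a convolution of summable sequences.
  refine Summable.of_nonneg_of_le (fun k => mul_nonneg (by positivity) (hp.nonneg _)) (fun k => ?_)
    (h1.mul_left (n : ℝ))
  rw [← mul_assoc]
  refine mul_le_mul_of_nonneg_right ?_ (hp.nonneg _)
  unfold lossRate
  have : (n : ℝ) * (2 + ((k : ℝ) + 1) / n) = 2 * n + (k + 1) := by field_simp
  rw [this]
  push_cast
  linarith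

lemma IsQuadraticLaw.mean_pos (hn : 1 ≤ n) (hp : IsQuadraticLaw (lossRate n) p) :
    0 < ∑' k : ℕ, ((k : ℝ) + 1) * p k := by
  have h := (hp.summable hn).hasSum
  have := hasSum_le (fun k => ?_) hp.hasSum h
  · linarith
  · nlinarith [hp.nonneg k, (Nat.cast_nonneg k : (0 : ℝ) ≤ k)]

/-- Size-biasing linearises the equation: the factor k + 2 carried by `p (k + 1)` is exactly what
`sum_antidiagonal_mul_succ` produces. -/
lemma IsQuadraticLaw.isLinearLaw (hn : 1 ≤ n) (hp : IsQuadraticLaw (lossRate n) p) :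
    IsLinearLaw (lossRate n) p
      fun k => ((k : ℝ) + 1) * p k / ∑' k : ℕ, ((k : ℝ) + 1) * p k := by
  have hm := hp.mean_pos hn
  set m := ∑' k : ℕ, ((k : ℝ) + 1) * p k with hmdef
  refine ⟨fun k => div_nonneg (mul_nonneg (by positivity) (hp.nonneg k)) hm.le, ?_, fun k => ?_⟩
  · have := (hp.summable hn).hasSum.div_const m
    rwa [← hmdef, div_self hm.ne'] at this
  · have h1 := sum_antidiagonal_mul_succ p k
    rw [← hp.eqn k] at h1
    simp_rw [← mul_div_assoc]
    rw [← Finset.sum_div, ← mul_div_assoc, h1]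
    push_cast
    ring

/-- The sequence with `c_{k+1} = p_k / ∑_j (j + 1) p_j`. -/
noncomputable def equilibriumOfLaw (p : ℕ → ℝ) : ℕ → ℝ
  | 0 => 0
  | k + 1 => p k / ∑' k : ℕ, ((k : ℝ) + 1) * p k

open Finset.HasAntidiagonal in
lemma sum_Ico_eq_sum_antidiagonal (c : ℕ → ℝ) (k : ℕ) :
    ∑ i ∈ Finset.Ico 1 (k + 2), c i * c (k + 2 - i) =
      ∑ x ∈ antidiagonal k, c (x.1 + 1) * c (x.2 + 1) := by
  rw [Finset.Nat.sum_antidiagonal_eq_sum_range_succ (fun i j => c (i + 1) * c (j + 1)),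
    Finset.sum_Ico_eq_sum_range]
  refine Finset.sum_congr (by simp) fun i hi => ?_
  rw [Finset.mem_range] at hi
  rw [show 1 + i = i + 1 by omega, show k + 2 - (i + 1) = k - i + 1 by omega]

lemma IsQuadraticLaw.isEquilibrium (hn : 1 ≤ n) (hp : IsQuadraticLaw (lossRate n) p) :
    IsEquilibrium n (equilibriumOfLaw p) := by
  have hm := hp.mean_pos hn
  set m := ∑' k : ℕ, ((k : ℝ) + 1) * p k with hmdef
  have hc : ∀ k, equilibriumOfLaw p (k + 1) = p k / m := fun k => rfl
  have hm₀ : m₀ (equilibriumOfLaw p) = 1 / m := by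
    have h1 : HasSum (fun k => equilibriumOfLaw p (k + 1)) (1 / m) := hp.hasSum.div_const m
    have h2 := (hasSum_nat_add_iff 1).1 h1
    simp only [Finset.range_one, Finset.sum_singleton, equilibriumOfLaw, add_zero] at h2
    exact h2.tsum_eq
  refine ⟨rfl, ?_, ?_, ?_⟩
  · rintro (_ | k)
    · exact le_rfl
    · exact div_nonneg (hp.nonneg k) hm.le
  · have h1 := (hp.summable hn).hasSum.div_const m
    rw [← hmdef, div_self hm.ne'] at h1
    have h3 : HasSum (fun k : ℕ => ((k + 1 : ℕ) : ℝ) * equilibriumOfLaw p (k + 1)) 1 := by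
      refine (funext fun k => ?_ : (fun k : ℕ => ((k + 1 : ℕ) : ℝ) * equilibriumOfLaw p (k + 1)) =
        fun k : ℕ => ((k : ℝ) + 1) * p k / m) ▸ h1
      rw [hc]
      push_cast
      ring
    have h2 := (hasSum_nat_add_iff (f := fun k : ℕ => (k : ℝ) * equilibriumOfLaw p k) 1).1 h3
    simpa using h2
  · intro k hk
    obtain ⟨k, rfl⟩ := Nat.exists_eq_add_of_le' hk
    rw [sum_Ico_eq_sum_antidiagonal, hm₀]
    simp_rw [hc]
    have h1 := hp.eqn k
    have h2 : ∑ x ∈ Finset.HasAntidiagonal.antidiagonal k, p x.1 / m * (p x.2 / m) =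
        (∑ x ∈ Finset.HasAntidiagonal.antidiagonal k, p x.1 * p x.2) / m ^ 2 := by
      rw [Finset.sum_div]
      refine Finset.sum_congr rfl fun x _ => ?_
      ring
    rw [h2, ← h1, show k + 2 = (k + 1) + 1 from rfl, lossRate]
    push_cast
    field_simp
    ring

/-- Dividing an equilibrium by `m₀ c` gives a quadratic law, hence `p`; the unit mass then fixes `m₀
c`. -/
lemma IsEquilibrium.eq_equilibriumOfLaw (hn : 1 ≤ n) (hp : IsQuadraticLaw (lossRate n) p)
    {c : ℕ → ℝ} (hc : IsEquilibrium n c) : c = equilibriumOfLaw p := by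
  have hle : ∀ k, c k ≤ k * c k := by
    rintro (_ | k)
    · simp [hc.zero]
    · have := hc.nonneg (k + 1)
      push_cast
      nlinarith [(Nat.cast_nonneg k : (0 : ℝ) ≤ k)]
  have hsum : Summable c := Summable.of_nonneg_of_le hc.nonneg hle hc.mass.summable
  have hs : HasSum c (m₀ c) := hsum.hasSum
  have h0 : 0 < m₀ c := by
    refine lt_of_le_of_ne (hs.nonneg hc.nonneg) fun h => ?_
    rw [← h] at hs
    have h1 := (hasSum_zero_iff_of_nonneg hc.nonneg).1 hs
    have h2 := hc.mass
    rw [h1] at h2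
    simp only [Pi.zero_apply, mul_zero] at h2
    exact zero_ne_one (hasSum_zero.unique h2)
  have hlaw : IsQuadraticLaw (lossRate n) fun k => c (k + 1) / m₀ c := by
    refine ⟨fun k => div_nonneg (hc.nonneg _) h0.le, ?_, fun k => ?_⟩
    · have h1 : HasSum (fun k => c (k + 1)) (m₀ c) := by
        rw [hasSum_nat_add_iff 1]
        simpa [hc.zero] using hs
      have := h1.div_const (m₀ c)
      rwa [div_self h0.ne'] at this
    · have h1 := hc.eqn (k + 2) (by omega)
      rw [sum_Ico_eq_sum_antidiagonal] at h1
      have h2 : ∑ x ∈ Finset.HasAntidiagonal.antidiagonal k,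
          c (x.1 + 1) / m₀ c * (c (x.2 + 1) / m₀ c) =
          (∑ x ∈ Finset.HasAntidiagonal.antidiagonal k, c (x.1 + 1) * c (x.2 + 1)) / m₀ c ^ 2 := by
        rw [Finset.sum_div]
        refine Finset.sum_congr rfl fun x _ => ?_
        ring
      have h3 : lossRate n k * c (k + 2) =
          1 / m₀ c * ∑ x ∈ Finset.HasAntidiagonal.antidiagonal k, c (x.1 + 1) * c (x.2 + 1) := by
        rw [← h1, lossRate]
        push_cast
        ring
      rw [h2, ← mul_div_assoc, show k + 1 + 1 = k + 2 from rfl, h3]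
      field_simp
  have hpeq := hlaw.unique (lossRate_pos n) hp
  have hcp : ∀ k, c (k + 1) = m₀ c * p k := by
    intro k
    rw [← hpeq]
    field_simp
  have hmass : m₀ c * ∑' k : ℕ, ((k : ℝ) + 1) * p k = 1 := by
    have h1 : HasSum (fun k : ℕ => ((k + 1 : ℕ) : ℝ) * c (k + 1)) 1 := by
      rw [hasSum_nat_add_iff (f := fun k : ℕ => (k : ℝ) * c k) 1]
      simpa using hc.mass
    have h2 := (hp.summable hn).hasSum.mul_left (m₀ c)
    refine h2.unique ?_
    refine (funext fun k => ?_ : (fun k : ℕ => ((k + 1 : ℕ) : ℝ) * c (k + 1)) =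
      fun k : ℕ => m₀ c * (((k : ℝ) + 1) * p k)) ▸ h1
    rw [hcp]
    push_cast
    ring
  have hm := hp.mean_pos hn
  funext k
  rcases k with _ | k
  · exact hc.zero
  · rw [hcp, equilibriumOfLaw, eq_div_iff hm.ne', mul_right_comm, hmass, one_mul]

end
/-! ### The law of the number of leaves -/

open Filter Topology

/-- A vertex which does not branch has no alive nodes at any depth, so going beyond a frontier of
such vertices changes nothing. -/
lemma alive_succ_of_terminates {N : Vertex → ℕ} (e : Vertex → Vertex → Prop) {d : ℕ} {v : Vertex}
    (h : Terminates (fun v => N v ≠ 2) d v) : alive N e (d + 1) v = alive N e d v := by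
  have h0 : ∀ d v, N v ≠ 2 → alive N e d v = ∅ := by
    intro d v hv
    cases d with
    | zero => rfl
    | succ d =>
      rw [alive, grow, if_neg hv]
      exact cutIf_eq_self (by simp)
  induction d generalizing v with
  | zero => rw [h0 _ _ h, h0 _ _ h]
  | succ d ih =>
    rcases h with h | h
    · rw [h0 _ _ h, h0 _ _ h]
    · rw [alive, ih h.1, ih h.2, alive]

lemma alive_eq_of_terminates {N : Vertex → ℕ} (e : Vertex → Vertex → Prop) {d d' : ℕ} {v : Vertex}
    (h : Terminates (fun v => N v ≠ 2) d v) (hd : d ≤ d') : alive N e d' v = alive N e d v := by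
  induction hd with
  | refl => rfl
  | step hd ih => rw [alive_succ_of_terminates e (h.le hd), ih]

/-! ### Limits as the truncation depth tends to infinity. -/

section

variable {Ω : Type*} [mΩ : MeasurableSpace Ω] {P : Measure Ω}

lemma exists_measurable_eventually_eq {X : ℕ → Ω → ℕ} (hX : ∀ d, Measurable (X d))
    (h : ∀ᵐ ω ∂P, ∃ y, ∀ᶠ d in atTop, X d ω = y) :
    ∃ Y : Ω → ℕ, Measurable Y ∧ ∀ᵐ ω ∂P, ∀ᶠ d in atTop, X d ω = Y ω := by
  obtain ⟨Y, hY, hlim⟩ := measurable_limit_of_tendsto_metrizable_ae (L := atTop) (μ := P)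
    (fun d => (hX d).aemeasurable) (h.mono fun ω ⟨y, hy⟩ => ⟨y, tendsto_nhds_of_eventually_eq hy⟩)
  refine ⟨Y, hY, hlim.mono fun ω hω => ?_⟩
  rwa [nhds_discrete, tendsto_pure] at hω

variable [IsProbabilityMeasure P]

lemma tendsto_real_of_eventually_eq {X : ℕ → Ω → ℕ} (hX : ∀ d, Measurable (X d)) {Y : Ω → ℕ}
    (hY : Measurable Y) (h : ∀ᵐ ω ∂P, ∀ᶠ d in atTop, X d ω = Y ω) (k : ℕ) :
    Tendsto (fun d => (P {ω | X d ω = k}).toReal) atTop (𝓝 (P {ω | Y ω = k}).toReal) := by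
  refine (ENNReal.tendsto_toReal (measure_ne_top _ _)).comp ?_
  refine tendsto_measure_of_ae_tendsto_indicator_of_isFiniteMeasure atTop
    (hY (measurableSet_singleton k)) (fun d => hX d (measurableSet_singleton k)) ?_
  filter_upwards [h] with ω hω
  filter_upwards [hω] with d hd
  show X d ω = k ↔ Y ω = k
  rw [hd]

lemma hasSum_real_singleton {Y : Ω → ℕ} (hY : Measurable Y) :
    HasSum (fun k => (P {ω | Y ω = k}).toReal) 1 := by
  have h1 : ∑' k, P {ω | Y ω = k} = 1 := by
    rw [← measure_iUnion (f := fun k => {ω | Y ω = k}) _ fun k => hY (measurableSet_singleton k)]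
    · have : ⋃ k, {ω | Y ω = k} = Set.univ := by
        ext ω
        simp
      rw [this, measure_univ]
    · intro i j hij
      rw [Function.onFun, Set.disjoint_left]
      intro ω (h1 : Y ω = i) (h2 : Y ω = j)
      exact hij (h1.symm.trans h2)
  have h2 := ENNReal.hasSum_toReal (f := fun k => P {ω | Y ω = k}) (by simp [h1])
  rwa [← ENNReal.tsum_toReal_eq fun k => measure_ne_top _ _, h1] at h2

variable {n : ℕ} {ν : ℕ → Vertex → Ω → ℕ} {κ : Vertex → Ω → ℝ} {π : Vertex → Ω → Set ℝ}

namespace IsInput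

lemma ae_planted_eventually_eq (h : IsInput P n ν κ π) :
    ∀ᵐ ω ∂P, ∃ y, ∀ᶠ d in atTop, aliveCard ν κ π d [0] ω = y := by
  filter_upwards [h.ae_extinct] with ω hω
  obtain ⟨d₀, hd₀⟩ := hω 0
  refine ⟨aliveCard ν κ π d₀ [0] ω, eventually_atTop.2 ⟨d₀, fun d hd => ?_⟩⟩
  exact congrArg Finset.card (alive_eq_of_terminates _ hd₀ hd)

/-- The count at the root stabilises although the tree is infinite, since a backbone vertex with an
own mark hides what lies above it. -/
lemma ae_root_eventually_eq (h : IsInput P n ν κ π) (hn : 1 ≤ n) :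
    ∀ᵐ ω ∂P, (prunedTree ν κ π ω).Finite ∧ ∀ᶠ d in atTop,
      (leaves (prunedTree ν κ π ω)).ncard = aliveCard ν κ π d [] ω + 1 := by
  filter_upwards [h.ae_isRegular hn] with ω hω
  obtain ⟨d₀, hd₀⟩ := hω.exists_alive
  refine ⟨(hd₀ d₀ le_rfl).1, eventually_atTop.2 ⟨d₀, fun d hd => ?_⟩⟩
  rw [aliveCard, posHits_eq_hits hω.length_pos]
  exact (hd₀ d hd).2

lemma lossRate_mul_planted (h : IsInput P n ν κ π) (d k : ℕ) :
    lossRate n k * (P {ω | aliveCard ν κ π (d + 1) [0] ω = k + 1}).toReal =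
      ∑ x ∈ Finset.HasAntidiagonal.antidiagonal k,
        (P {ω | aliveCard ν κ π d [0] ω = x.1}).toReal *
        (P {ω | aliveCard ν κ π d [0] ω = x.2}).toReal := by
  rw [h.measure_aliveCard_planted_succ, ENNReal.toReal_mul, ENNReal.toReal_mul,
    ENNReal.toReal_ofReal (by positivity), ENNReal.toReal_sum
      fun x _ => ENNReal.mul_ne_top (measure_ne_top _ _) (measure_ne_top _ _)]
  have := lossRate_pos n k
  unfold lossRate at *
  simp only [ENNReal.toReal_mul, ENNReal.toReal_div, ENNReal.toReal_one, ENNReal.toReal_ofNat]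
  push_cast
  field_simp

lemma lossRate_mul_spine (h : IsInput P n ν κ π) (d k : ℕ) :
    lossRate n k * (P {ω | aliveCard ν κ π (d + 1) [] ω = k + 1}).toReal =
      2 * ∑ x ∈ Finset.HasAntidiagonal.antidiagonal k,
        (P {ω | aliveCard ν κ π d [0] ω = x.1}).toReal *
        (P {ω | aliveCard ν κ π d [] ω = x.2}).toReal := by
  rw [h.measure_aliveCard_spine_succ, ENNReal.toReal_mul,
    ENNReal.toReal_ofReal (by positivity), ENNReal.toReal_sum
      fun x _ => ENNReal.mul_ne_top (measure_ne_top _ _) (measure_ne_top _ _)]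
  have := lossRate_pos n k
  unfold lossRate at *
  simp only [ENNReal.toReal_mul]
  push_cast
  field_simp

/-- The number of leaves of the pruned tree has the size-biased law of the equilibrium. -/
lemma exists_law (h : IsInput P n ν κ π) (hn : 1 ≤ n) :
    AEMeasurable (fun ω => (leaves (prunedTree ν κ π ω)).ncard) P ∧
    ∃ p, IsQuadraticLaw (lossRate n) p ∧ ∀ k,
      P {ω | (leaves (prunedTree ν κ π ω)).ncard = k + 1} =
        ENNReal.ofReal ((k + 1 : ℕ) * equilibriumOfLaw p (k + 1)) := by
  obtain ⟨Y, hY, hYlim⟩ := exists_measurable_eventually_eq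
    (fun d => h.measurable_aliveCard d [0]) h.ae_planted_eventually_eq
  obtain ⟨Z, hZ, hZlim⟩ := exists_measurable_eventually_eq (P := P)
    (fun d => h.measurable_aliveCard d []) <| (h.ae_root_eventually_eq hn).mono fun ω hω =>
      -- The truncated subtraction is harmless: the number of leaves is eventually `aliveCard` plus
      -- one.
      ⟨(leaves (prunedTree ν κ π ω)).ncard - 1, hω.2.mono fun d hd => by omega⟩
  have hp := tendsto_real_of_eventually_eq (fun d => h.measurable_aliveCard d [0]) hY hYlim
  have hs := tendsto_real_of_eventually_eq (fun d => h.measurable_aliveCard d []) hZ hZlim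
  have hleaves : ∀ᵐ ω ∂P, (leaves (prunedTree ν κ π ω)).ncard = Z ω + 1 := by
    filter_upwards [h.ae_root_eventually_eq hn, hZlim] with ω h1 h2
    obtain ⟨d, hd⟩ := (h1.2.and h2).exists
    rw [hd.1, hd.2]
  refine ⟨(hZ.add_const 1).aemeasurable.congr (hleaves.mono fun ω hω => hω.symm),
    fun k => (P {ω | Y ω = k}).toReal, ?_⟩
  have hquad : IsQuadraticLaw (lossRate n) fun k => (P {ω | Y ω = k}).toReal := by
    refine ⟨fun k => ENNReal.toReal_nonneg, hasSum_real_singleton hY, fun k => ?_⟩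
    -- The recursion links depths d + 1 and d; in the limit both sides involve the same law.
    refine tendsto_nhds_unique
      (((hp (k + 1)).comp (tendsto_add_atTop_nat 1)).const_mul (lossRate n k)) ?_
    refine Tendsto.congr (fun d => (h.lossRate_mul_planted d k).symm) ?_
    exact tendsto_finsetSum _ fun x _ => (hp x.1).mul (hp x.2)
  have hlin : IsLinearLaw (lossRate n) (fun k => (P {ω | Y ω = k}).toReal)
      fun k => (P {ω | Z ω = k}).toReal := by
    refine ⟨fun k => ENNReal.toReal_nonneg, hasSum_real_singleton hZ, fun k => ?_⟩
    refine tendsto_nhds_unique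
      (((hs (k + 1)).comp (tendsto_add_atTop_nat 1)).const_mul (lossRate n k)) ?_
    refine Tendsto.congr (fun d => (h.lossRate_mul_spine d k).symm) ?_
    exact (tendsto_finsetSum _ fun x _ => (hp x.1).mul (hs x.2)).const_mul 2
  refine ⟨hquad, fun k => ?_⟩
  -- The law at the root and the size-biased planted law solve the same linear equation.
  have h1 := congrFun (hlin.unique (lossRate_pos n) hquad.nonneg (hquad.isLinearLaw hn)) k
  have h2 : P {ω | (leaves (prunedTree ν κ π ω)).ncard = k + 1} = P {ω | Z ω = k} := by
    refine measure_congr ?_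
    filter_upwards [hleaves] with ω hω
    exact propext (show (leaves (prunedTree ν κ π ω)).ncard = k + 1 ↔ Z ω = k by omega)
  rw [h2, ← ENNReal.ofReal_toReal (measure_ne_top P {ω | Z ω = k})]
  congr 1
  rw [equilibriumOfLaw, ← mul_div_assoc]
  push_cast
  exact h1

end IsInput
end
end ForestFire

/-! ### Assembly of the pathwise statements and of the law. -/

theorem mainTheorem5 {Ω : Type*} [MeasurableSpace Ω] (P : MeasureTheory.Measure Ω)
    [MeasureTheory.IsProbabilityMeasure P] (n : ℕ) (hn : 1 ≤ n)
    (ν : ℕ → ForestFire.Vertex → Ω → ℕ) (κ : ForestFire.Vertex → Ω → ℝ)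
    (π : ForestFire.Vertex → Ω → Set ℝ) (hinput : ForestFire.IsInput P n ν κ π) :
    -- the pruning procedure is a.s. well defined on the infinite tree
    (∀ᵐ ω ∂P, ForestFire.PruningWellDefined (ForestFire.sizeBiasedTree ν ω)
      (fun v => κ v ω) (fun v => π v ω)) ∧
    -- the pruned tree is a.s. finite
    (∀ᵐ ω ∂P, (ForestFire.prunedTree ν κ π ω).Finite) ∧
    -- perfect simulation: some backbone edge a.s. carries a mark sent by its upper endpoint, and
    -- pruning the finite tree in which this endpoint is made a leaf yields the same pruned tree
    (∀ᵐ ω ∂P, (∃ j, ForestFire.HasOwnMark κ π ω j) ∧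
      ∀ j, ForestFire.HasOwnMark κ π ω j →
        (ForestFire.truncate (ForestFire.sizeBiasedTree ν ω) (ForestFire.spine j)).Finite ∧
        ForestFire.PruningWellDefined
          (ForestFire.truncate (ForestFire.sizeBiasedTree ν ω) (ForestFire.spine j))
          (fun v => κ v ω) (fun v => π v ω) ∧
        ForestFire.prunedTree ν κ π ω =
          ForestFire.prune
            (ForestFire.truncate (ForestFire.sizeBiasedTree ν ω) (ForestFire.spine j))
            (fun v => κ v ω) (fun v => π v ω)) ∧
    -- the number of leaves of the pruned tree has law `(k c_k)_{k ≥ 1}`, where `c` is the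
    -- equilibrium
    AEMeasurable (fun ω => (ForestFire.leaves (ForestFire.prunedTree ν κ π ω)).ncard) P ∧
    ∃ c : ℕ → ℝ, ForestFire.IsEquilibrium n c ∧
      (∀ c' : ℕ → ℝ, ForestFire.IsEquilibrium n c' → c' = c) ∧
      ∀ k : ℕ, 1 ≤ k →
        P {ω | (ForestFire.leaves (ForestFire.prunedTree ν κ π ω)).ncard = k} =
          ENNReal.ofReal (k * c k) := by
  have hreg := hinput.ae_isRegular hn
  obtain ⟨hmeas, p, hp, hlaw⟩ := hinput.exists_law hn
  refine ⟨hreg.mono fun ω hω => hω.pruningWellDefined,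
    (hinput.ae_root_eventually_eq hn).mono fun ω hω => hω.1, hreg.mono fun ω hω => ?_, hmeas,
    ForestFire.equilibriumOfLaw p, hp.isEquilibrium hn,
    fun c' hc' => hc'.eq_equilibriumOfLaw hn hp, ?_⟩
  · have hown : ∀ j, ForestFire.HasOwnMark κ π ω j ↔
        ForestFire.Hits (fun v => κ v ω) (fun v => π v ω) (ForestFire.spine j) [] := by
      intro j
      constructor
      · rintro ⟨h, hh, -, hI⟩
        exact ⟨h, by simpa using hh, hI⟩
      · rintro ⟨h, hh, hI⟩
        exact ⟨h, by simpa using hh, List.prefix_refl _, hI⟩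
    refine ⟨?_, fun j hj => ⟨hω.finite_truncate j, hω.pruningWellDefined_truncate j, ?_⟩⟩
    · obtain ⟨j, -, hj⟩ := hω.own_mark 0
      exact ⟨j, (hown j).2 hj⟩
    · exact ForestFire.prune_truncate hω.length_pos hω.pruningWellDefined ((hown j).1 hj)
        (hω.spine_mem_nodes j) (hω.pruningWellDefined_truncate j)
  · intro k hk
    obtain ⟨k, rfl⟩ := Nat.exists_eq_add_of_le' hk
    exact hlaw k
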